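/- Let $(H,N)$ be any real normed space (not necessarily Hilbertian, complete or finite dimensional) and let $C\subset H$ be closed and convex. For $h\in H$ write $d(h,C)=\inf_{c\in C}N(h-c)$ (with $d(h,\emptyset)=+\infty$). In the game repeated at stages $1,2,\dots$ with action sets $A$ (player) and $B$ (Nature) and payoffs $g_n=g(a_n,b_n)\in H$, put $\overline g_n=\frac1n\sum_{m=1}^n g_m$. A strategy of the player (of Nature) maps each finite history $(a_1,b_1,\dots,a_n,b_n)$, measurably, to a probability distribution on $A$ (on $B$), the two actions of a stage being drawn independently given the history; a pair $(\sigma,\tau)$ of strategies induces a law $\mathbb P_{\sigma,\tau}$ on infinite histories. The set $C$ is *approachable* if the player has a strategy $\sigma$ such that for every $\varepsilon>0$ there is $N_\varepsilon\in\mathbb N$ such that, for every strategy $\tau$ of Nature, $$\sup_{n\ge N_\varepsilon}\mathbb E_{\sigma,\tau}\big[d(\overline g_n,C)\big]\le\varepsilon\quad\text{and}\quad \mathbb P_{\sigma,\tau}\Big(\sup_{n\ge N_\varepsilon}d(\overline g_n,C)\ge\varepsilon\Big)\le\varepsilon .$$ It is *approachable in pure strategies* if the player has a pure strategy $\sigma$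 (a map from finite histories to actions) such that for every $\varepsilon>0$ there is $N_\varepsilon$ with $d(\overline g_n,C)\le\varepsilon$ for all $n\ge N_\varepsilon$ and all pure strategies of Nature. A map on a product of two convex sets is called *bilinear* if it is affine in each variable. Then: 1. (Finite action sets.) Let $A,B$ be finite non-empty sets, $\Delta(A),\Delta(B)$ the simplices of probability distributions on them, and $g:\Delta(A)\times\Delta(B)\to H$ continuous and bilinear; the payoff of a pair of actions is $g(a,b):=g(\delta_a,\delta_b)$. Then $$C\text{ is approachable}\iff\forall y\in\Delta(B),\ \exists x\in\Delta(A),\ g(x,y)\in C .$$ 2. (Compact convex action sets.) Let $A,B$ be non-empty compact convex subsets of real Hausdorff topological vector spaces and $g:A\times B\to H$ continuous and bilinear. Then $$C\text{ is approachable in pure strategies}\iff\forall y\in B,\ \exists x\in A,\ g(x,y)\in C ,$$ and, if $A$ and $B$ are metrizable (with their Borel $\sigma$-algebras), this condition is also equivalent to $C$ being approachable. -/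

import Mathlib

open MeasureTheory ProbabilityTheory

open scoped ENNReal

noncomputable section

namespace RepeatedGame

/-- `g` is affine in each of its two variables on the convex sets `K` and `L`, that is, it commutes
with convex combinations in each variable: the meaning of "bilinear" for a map that is only given
on a product of two convex sets (such as two simplices). -/
def IsBiaffineOn {E F H : Type*} [AddCommGroup E] [Module ℝ E] [AddCommGroup F] [Module ℝ F]
    [AddCommGroup H] [Module ℝ H] (K : Set E) (L : Set F) (g : E → F → H) : Prop :=
  (∀ x ∈ K, ∀ x' ∈ K, ∀ y ∈ L, ∀ s t : ℝ, 0 ≤ s → 0 ≤ t → s + t = 1 →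
      g (s • x + t • x') y = s • g x y + t • g x' y) ∧
  (∀ x ∈ K, ∀ y ∈ L, ∀ y' ∈ L, ∀ s t : ℝ, 0 ≤ s → 0 ≤ t → s + t = 1 →
      g x (s • y + t • y') = s • g x y + t • g x y')

/-- The vertex of the simplex `Δ(A)` given by the action `a`: the Dirac mass at `a`. -/
def dirac {A : Type*} (a : A) : A → ℝ :=
  open Classical in Pi.single a 1

/-- Average payoff of the first `n` stages along the infinite history `h`
(stage `m + 1` is the coordinate `h m`). -/
def avgPayoff {A B H : Type*} [AddCommGroup H] [Module ℝ H] (g : A → B → H)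
    (h : ℕ → A × B) (n : ℕ) : H :=
  (n : ℝ)⁻¹ • ∑ m ∈ Finset.range n, g (h m).1 (h m).2

/-! ### Randomized strategies -/

/-- A (behavioural) strategy in the repeated game with action sets `A` (player) and `B` (Nature) for
the one who chooses actions in `S` (where `S = A` or `S = B`): to each finite history of length `n`
it associates, measurably, a probability distribution on `S`. On finite sets of actions the
measurability is automatic. -/
structure Strategy (A B S : Type*) [MeasurableSpace A] [MeasurableSpace B]
    [MeasurableSpace S] where
  kernel : ∀ n : ℕ, Kernel (Fin n → A × B) S
  isMarkovKernel : ∀ n : ℕ, IsMarkovKernel (kernel n)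

section Law

variable {A B : Type*} [MeasurableSpace A] [MeasurableSpace B]

/-- The law of the pair of actions of stage `n + 1` given the history of the first `n` stages: the
two actions are drawn independently according to the two strategies. -/
def stageKernel (σ : Strategy A B A) (τ : Strategy A B B) (n : ℕ) :
    Kernel (Fin n → A × B) (A × B) :=
  σ.kernel n ×ₖ τ.kernel n

/-- A history indexed by `{0, …, n}` read as a history of length `n + 1`. -/
def toHistory (n : ℕ) (h : (i : Finset.Iic n) → A × B) : Fin (n + 1) → A × B :=
  fun i => h ⟨i, Finset.mem_Iic.2 (Nat.le_of_lt_succ i.2)⟩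

theorem measurable_toHistory (n : ℕ) :
    Measurable (toHistory n : ((i : Finset.Iic n) → A × B) → Fin (n + 1) → A × B) :=
  measurable_pi_lambda _ fun _ => measurable_pi_apply _

/-- The same law, on histories indexed by `{0, …, n}`. -/
def nextKernel (σ : Strategy A B A) (τ : Strategy A B B) (n : ℕ) :
    Kernel ((i : Finset.Iic n) → A × B) (A × B) :=
  (stageKernel σ τ (n + 1)).comap (toHistory n) (measurable_toHistory n)

instance (σ : Strategy A B A) (τ : Strategy A B B) (n : ℕ) :
    IsMarkovKernel (stageKernel σ τ n) := by
  have := σ.isMarkovKernel n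
  have := τ.isMarkovKernel n
  unfold stageKernel
  infer_instance

instance (σ : Strategy A B A) (τ : Strategy A B B) (n : ℕ) :
    IsMarkovKernel (nextKernel σ τ n) := by
  unfold nextKernel
  infer_instance

/-- The probability distribution on infinite histories that is induced by a pair of strategies. -/
def law (σ : Strategy A B A) (τ : Strategy A B B) : Measure (ℕ → A × B) :=
  Kernel.trajMeasure (X := fun _ => A × B) (stageKernel σ τ 0 Fin.elim0) (nextKernel σ τ)

instance (σ : Strategy A B A) (τ : Strategy A B B) : IsProbabilityMeasure (law σ τ) := by
  unfold law
  infer_instance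

end Law

/-- `C` is approachable by the player in the repeated game with payoff `g`: the player has a
strategy such that for every `ε > 0` there is a stage `N` such that, for every strategy of Nature,
`sup_{n ≥ N} 𝔼 [d(ḡ_n, C)] ≤ ε` and `ℙ (sup_{n ≥ N} d(ḡ_n, C) ≥ ε) ≤ ε`. The distance to a set is
taken in `[0, ∞]`, so that the distance to the empty set is `∞`. -/
def Approachable {A B H : Type*} [MeasurableSpace A] [MeasurableSpace B]
    [NormedAddCommGroup H] [NormedSpace ℝ H] (g : A → B → H) (C : Set H) : Prop :=
  ∃ σ : Strategy A B A, ∀ ε : ℝ, 0 < ε → ∃ N : ℕ, ∀ τ : Strategy A B B,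
    (⨆ n ≥ N, ∫⁻ h, Metric.infEDist (avgPayoff g h n) C ∂(law σ τ)) ≤ ENNReal.ofReal ε ∧
    law σ τ {h | ENNReal.ofReal ε ≤ ⨆ n ≥ N, Metric.infEDist (avgPayoff g h n) C}
      ≤ ENNReal.ofReal ε

/-! ### Pure strategies -/

/-- A pure strategy: to each finite history it associates an action. -/
abbrev PureStrategy (A B S : Type*) : Type _ := ∀ n : ℕ, (Fin n → A × B) → S

/-- The history of the first `n` stages generated by a pair of pure strategies. -/
def pureHistory {A B : Type*} (σ : PureStrategy A B A) (τ : PureStrategy A B B) :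
    (n : ℕ) → Fin n → A × B
  | 0 => Fin.elim0
  | n + 1 => Fin.snoc (α := fun _ => A × B) (pureHistory σ τ n)
      (σ n (pureHistory σ τ n), τ n (pureHistory σ τ n))

/-- The infinite history generated by a pair of pure strategies. -/
def purePlay {A B : Type*} (σ : PureStrategy A B A) (τ : PureStrategy A B B) (n : ℕ) : A × B :=
  (σ n (pureHistory σ τ n), τ n (pureHistory σ τ n))

/-- `C` is approachable by the player in pure strategies: the player has a pure strategy such that
`d(ḡ_n, C)` tends to `0`, uniformly with respect to the pure strategies of Nature. -/
def PurelyApproachable {A B H : Type*} [NormedAddCommGroup H] [NormedSpace ℝ H]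
    (g : A → B → H) (C : Set H) : Prop :=
  ∃ σ : PureStrategy A B A, ∀ ε : ℝ, 0 < ε → ∃ N : ℕ, ∀ τ : PureStrategy A B B, ∀ n ≥ N,
    Metric.infEDist (avgPayoff g (purePlay σ τ) n) C ≤ ENNReal.ofReal ε

end RepeatedGame

end

/-! Sufficiency. In a Hilbert space one would follow Blackwell and control the squared distance to
$C$. A general norm is not smooth, so the squared distance is replaced by a smooth potential. All
payoffs lie in a totally bounded convex set $\Gamma$. Countably many functionals $f_j$ of norm at
most one, with $f_j\le c_j$ on $C$, detect the distance to $C$ uniformly on $\Gamma$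
(`exists_isTestFamily`), through $\Phi(s)=\sum_j 2^{-j}(s_j^+)^2$ evaluated at the excesses
$s_j=f_j(z)-c_j$. Adding an increment $t$ with $|t_j|\le R$ raises $\Phi$ by at most twice the
coupling $\sum_j 2^{-j}s_j^+t_j$ plus $2R^2$ (`potential_add_le`).

For fixed past excesses $s$, the coupling with the next excess is a continuous affine function of
the next payoff, and it is nonpositive at points of $C$. Since the player can answer every $y$ by a
payoff in $C$, Sion's minimax theorem gives one action that makes the coupling nonpositive against
all $y$ (`IsTestFamily.exists_coupling_nonpos`). The potential of the summed excesses then grows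
linearly in $n$, while averaging divides it by $n^2$.

For randomized strategies the same estimate holds in conditional expectation, with a tolerance of 1
in the coupling that leaves room for a measurable choice. A supermartingale maximal inequality
(`mul_law_exists_le`) turns it into the bound on the probability.

Necessity. If no answer to $y$ has its payoff in $C$, the compact convex set of payoffs against $y$
is strictly separated from $C$. Nature plays $y$ at every stage, and the average payoff stays away
from $C$, surely or in expectation (`not_purelyApproachable`, `not_approachable`). -/

noncomputable section

namespace RepeatedGame

/-! ### The potential -/

/-- A weighted sum of the squares of the positive parts of a sequence. -/
def potential (s : ℕ → ℝ) : ℝ := ∑' j, (1 / 2 : ℝ) ^ j * max (s j) 0 ^ 2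

/-- Half the derivative of `potential` at `s` in the direction `t`. -/
def coupling (s t : ℕ → ℝ) : ℝ := ∑' j, (1 / 2 : ℝ) ^ j * max (s j) 0 * t j

/-- The sum of the vectors `fun j => u j x` over the entries `x` of a finite history. -/
def total {X : Type*} (u : ℕ → X → ℝ) {n : ℕ} (h : Fin n → X) (j : ℕ) : ℝ := ∑ i, u j (h i)

theorem max_zero_le_of_abs_le {a S : ℝ} (h : |a| ≤ S) : max a 0 ≤ S :=
  max_le ((le_abs_self a).trans h) ((abs_nonneg a).trans h)

theorem summable_potential {s : ℕ → ℝ} {S : ℝ} (hs : ∀ j, |s j| ≤ S) :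
    Summable fun j => (1 / 2 : ℝ) ^ j * max (s j) 0 ^ 2 := by
  refine Summable.of_nonneg_of_le (fun j => by positivity) (fun j => ?_)
    (summable_geometric_two.mul_right (S ^ 2))
  have h0 : 0 ≤ max (s j) 0 := le_max_right _ _
  have h1 := max_zero_le_of_abs_le (hs j)
  gcongr

theorem summable_coupling {s t : ℕ → ℝ} {S R : ℝ} (hs : ∀ j, |s j| ≤ S) (ht : ∀ j, |t j| ≤ R) :
    Summable fun j => (1 / 2 : ℝ) ^ j * max (s j) 0 * t j := by
  refine Summable.of_norm_bounded (g := fun j => (1 / 2 : ℝ) ^ j * (S * R))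
    (summable_geometric_two.mul_right _) (fun j => ?_)
  have h0 : 0 ≤ max (s j) 0 := le_max_right _ _
  have h1 := max_zero_le_of_abs_le (hs j)
  have h2 : 0 ≤ S := h0.trans h1
  rw [Real.norm_eq_abs, abs_mul, abs_mul, abs_of_nonneg h0, abs_of_nonneg (by positivity),
    mul_assoc]
  gcongr
  exact ht j

theorem abs_coupling_le {s t : ℕ → ℝ} {S R : ℝ} (hs : ∀ j, |s j| ≤ S) (ht : ∀ j, |t j| ≤ R) :
    |coupling s t| ≤ 2 * (S * R) := by
  have h := tsum_of_norm_bounded (f := fun j => (1 / 2 : ℝ) ^ j * max (s j) 0 * t j)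
    (hasSum_geometric_two.mul_right (S * R)) (fun j => by
      have h0 : 0 ≤ max (s j) 0 := le_max_right _ _
      have h1 := max_zero_le_of_abs_le (hs j)
      have h2 : 0 ≤ S := h0.trans h1
      rw [Real.norm_eq_abs, abs_mul, abs_mul, abs_of_nonneg h0, abs_of_nonneg (by positivity),
        mul_assoc]
      gcongr
      exact ht j)
  exact h

theorem potential_nonneg (s : ℕ → ℝ) : 0 ≤ potential s :=
  tsum_nonneg (g := fun j => (1 / 2 : ℝ) ^ j * max (s j) 0 ^ 2) fun j => by positivity

theorem potential_smul {r : ℝ} (hr : 0 ≤ r) (s : ℕ → ℝ) :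
    potential (fun j => r * s j) = r ^ 2 * potential s := by
  unfold potential
  rw [← tsum_mul_left]
  congr 1 with j
  have : max (r * s j) 0 = r * max (s j) 0 := by
    rw [mul_max_of_nonneg _ _ hr, mul_zero]
  rw [this]
  ring

/-- When $a+b\ge 0$, it lies between $0$ and $a^++b$, and the right-hand side is the square of the
latter. -/
theorem max_add_sq_le (a b : ℝ) :
    max (a + b) 0 ^ 2 ≤ max a 0 ^ 2 + 2 * (max a 0 * b) + b ^ 2 := by
  have e : max a 0 ^ 2 + 2 * (max a 0 * b) + b ^ 2 = (max a 0 + b) ^ 2 := by ring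
  rw [e]
  rcases le_total (a + b) 0 with h | h
  · rw [max_eq_right h, zero_pow two_ne_zero]
    positivity
  · have h2 : a ≤ max a 0 := le_max_left _ _
    rw [max_eq_left h]
    gcongr

/-- This smoothness estimate replaces the expansion of a Hilbert norm. The constant is $\sum_j
2^{-j}R^2=2R^2$. -/
theorem potential_add_le {s t : ℕ → ℝ} {S R : ℝ} (hs : ∀ j, |s j| ≤ S) (ht : ∀ j, |t j| ≤ R) :
    potential (fun j => s j + t j) ≤ potential s + 2 * coupling s t + 2 * R ^ 2 := by
  have h1 := summable_potential hs
  have h2 := (summable_coupling hs ht).mul_left 2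
  have h3 : Summable fun j => (1 / 2 : ℝ) ^ j * R ^ 2 := summable_geometric_two.mul_right _
  have h4 : Summable fun j => (1 / 2 : ℝ) ^ j * max (s j + t j) 0 ^ 2 :=
    summable_potential (S := S + R) fun j => (abs_add_le _ _).trans (add_le_add (hs j) (ht j))
  have e : potential s + 2 * coupling s t + 2 * R ^ 2
      = ∑' j, ((1 / 2 : ℝ) ^ j * max (s j) 0 ^ 2 + 2 * ((1 / 2 : ℝ) ^ j * max (s j) 0 * t j)
        + (1 / 2 : ℝ) ^ j * R ^ 2) := by
    rw [(h1.add h2).tsum_add h3, h1.tsum_add h2, tsum_mul_left, tsum_mul_right, tsum_geometric_two]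
    rfl
  rw [e]
  refine h4.tsum_le_tsum (fun j => ?_) ((h1.add h2).add h3)
  have hb : t j ^ 2 ≤ R ^ 2 := sq_le_sq' (neg_le_of_abs_le (ht j)) (le_of_abs_le (ht j))
  have hw : (0 : ℝ) < (1 / 2 : ℝ) ^ j := by positivity
  calc (1 / 2 : ℝ) ^ j * max (s j + t j) 0 ^ 2
      ≤ (1 / 2 : ℝ) ^ j * (max (s j) 0 ^ 2 + 2 * (max (s j) 0 * t j) + R ^ 2) := by
        gcongr
        exact (max_add_sq_le _ _).trans (by gcongr)
    _ = _ := by ring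

theorem le_potential {s : ℕ → ℝ} {S : ℝ} (hs : ∀ j, |s j| ≤ S) (j : ℕ) :
    (1 / 2 : ℝ) ^ j * max (s j) 0 ^ 2 ≤ potential s :=
  (summable_potential hs).le_tsum j fun i _ => by positivity

/-! ### Accumulated excesses along a finite history -/

section Total

variable {X : Type*} {u : ℕ → X → ℝ}

theorem total_snoc {n : ℕ} (h : Fin n → X) (x : X) :
    total u (Fin.snoc (α := fun _ => X) h x) = fun j => total u h j + u j x := by
  funext j
  simp [total, Fin.sum_univ_castSucc]

theorem abs_total_le {R : ℝ} (hu : ∀ j x, |u j x| ≤ R) {n : ℕ} (h : Fin n → X) (j : ℕ) :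
    |total u h j| ≤ n * R := by
  refine (Finset.abs_sum_le_sum_abs _ _).trans ?_
  refine (Finset.sum_le_card_nsmul _ _ R fun i _ => hu j (h i)).trans ?_
  simp

theorem potential_snoc_le {R : ℝ} (hu : ∀ j x, |u j x| ≤ R) {n : ℕ} (h : Fin n → X) (x : X) :
    potential (total u (Fin.snoc (α := fun _ => X) h x)) ≤
      potential (total u h) + 2 * coupling (total u h) (fun j => u j x) + 2 * R ^ 2 := by
  rw [total_snoc]
  exact potential_add_le (abs_total_le hu h) fun j => hu j x

theorem potential_total_zero (h : Fin 0 → X) : potential (total u h) = 0 := by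
  simp [potential, total]

variable [MeasurableSpace X]

theorem measurable_total (hu : ∀ j, Measurable (u j)) (n j : ℕ) :
    Measurable fun h : Fin n → X => total u h j :=
  Finset.measurable_sum _ fun i _ => (hu j).comp (measurable_pi_apply i)

theorem measurable_potential_total (hu : ∀ j, Measurable (u j)) (n : ℕ) :
    Measurable fun h : Fin n → X => potential (total u h) :=
  Measurable.tsum fun j => (((measurable_total hu n j).max measurable_const).pow_const 2).const_mul _

theorem measurable_coupling_total (hu : ∀ j, Measurable (u j)) (n : ℕ) :
    Measurable fun p : (Fin n → X) × X => coupling (total u p.1) (fun j => u j p.2) :=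
  Measurable.tsum fun j =>
    ((((measurable_total hu n j).comp measurable_fst).max measurable_const).const_mul _).mul
      ((hu j).comp measurable_snd)

end Total

/-! ### Test functionals -/

/-- Continuous linear functionals `f j` and bounds `c j` of `f j` on `C` such that the excesses
`f j z - c j` detect, uniformly for `z` in `Γ`, how far `z` is from `C`. -/
structure IsTestFamily {H : Type*} [NormedAddCommGroup H] [NormedSpace ℝ H] (Γ C : Set H)
    (f : ℕ → H →L[ℝ] ℝ) (c : ℕ → ℝ) (R : ℝ) : Prop where
  norm_le : ∀ j, ‖f j‖ ≤ 1
  le_of_mem : ∀ j, ∀ x ∈ C, f j x ≤ c j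
  abs_le : ∀ j, ∀ z ∈ Γ, |f j z - c j| ≤ R
  infDist_le : ∀ z ∈ Γ, Metric.infDist z C ≤ R
  infDist_le_of_potential : ∀ ε > 0, ∃ η > 0, ∀ z ∈ Γ,
    potential (fun j => f j z - c j) < η → Metric.infDist z C ≤ ε

section TestFamily

variable {H : Type*} [NormedAddCommGroup H] [NormedSpace ℝ H]

/-- A continuous linear functional of norm at most one that separates a point from a convex set
by at least half their distance. -/
theorem exists_half_infDist_le {C : Set H} (hconv : Convex ℝ C) (z : H) (hne : C.Nonempty) :
    ∃ (f : H →L[ℝ] ℝ) (c : ℝ), ‖f‖ ≤ 1 ∧ (∀ x ∈ C, f x ≤ c) ∧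
      Metric.infDist z C / 2 ≤ f z - c := by
  rcases (Metric.infDist_nonneg (x := z) (s := C)).eq_or_lt with hd | hd
  · exact ⟨0, 0, by simp, by simp, by simp [← hd]⟩
  set d := Metric.infDist z C with hdef
  -- The open ball of radius $d(z,C)$ around `z` misses `C`.
  obtain ⟨F, r, hF, hC⟩ := geometric_hahn_banach_open (convex_ball z d) Metric.isOpen_ball hconv
    (Set.disjoint_left.2 fun x hx hxC => absurd (Metric.infDist_le_dist_of_mem (x := z) hxC)
      (not_le.2 (by rwa [Metric.mem_ball, dist_comm] at hx)))
  have hz : F z < r := hF z (Metric.mem_ball_self hd)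
  have hpos : 0 < ‖F‖ := by
    rw [norm_pos_iff]
    rintro rfl
    obtain ⟨x, hx⟩ := hne
    have := hC x hx
    simp at this hz
    linarith
  -- The norm of `F` need not be attained; a vector that reaches half of it suffices, which accounts
  -- for the factor one half in the conclusion.
  obtain ⟨v, hv, hFv⟩ : ∃ v : H, ‖v‖ < 1 ∧ ‖F‖ / 2 < F v := by
    obtain ⟨v, hv, hFv⟩ := F.exists_lt_apply_of_lt_opNorm (half_lt_self hpos)
    rcases le_total 0 (F v) with h | h
    · exact ⟨v, hv, by rwa [Real.norm_of_nonneg h] at hFv⟩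
    · exact ⟨-v, by rwa [norm_neg], by rw [map_neg]; rwa [Real.norm_of_nonpos h] at hFv⟩
  have hzv := hF (z + d • v) (by
    rw [mem_ball_iff_norm, add_sub_cancel_left, norm_smul, Real.norm_of_nonneg hd.le]
    nlinarith)
  rw [map_add, map_smul, smul_eq_mul] at hzv
  refine ⟨-(‖F‖⁻¹ • F), -(‖F‖⁻¹ * r), ?_, fun x hx => ?_, ?_⟩
  · rw [norm_neg, norm_smul, norm_inv, norm_norm, inv_mul_cancel₀ hpos.ne']
  · have := hC x hx
    simp only [neg_apply, smul_apply, smul_eq_mul]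
    gcongr
  · have h1 : d * (‖F‖ / 2) ≤ r - F z := by nlinarith
    have h2 : -(‖F‖⁻¹ * F z) - -(‖F‖⁻¹ * r) = (r - F z) / ‖F‖ := by field_simp; ring
    simp only [neg_apply, smul_apply, smul_eq_mul]
    rw [h2, le_div_iff₀ hpos]
    linarith

/-- Take one half-separating functional for each point of a dense sequence in `Γ`. By total
boundedness, finitely many of these points are enough at each scale, so the weights $2^{-j}$ are
bounded below on the functionals needed, which makes detection uniform. -/
theorem exists_isTestFamily {Γ C : Set H} (hΓ : TotallyBounded Γ) (hconv : Convex ℝ C)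
    (hne : (C ∩ Γ).Nonempty) : ∃ f c R, IsTestFamily Γ C f c R := by
  obtain ⟨p, hpC, hpΓ⟩ := hne
  obtain ⟨R, hR⟩ := Metric.isBounded_iff.1 hΓ.isBounded
  have hCne : C.Nonempty := ⟨p, hpC⟩
  have : TopologicalSpace.SeparableSpace Γ := hΓ.isSeparable.separableSpace
  have : Nonempty Γ := ⟨⟨p, hpΓ⟩⟩
  let z : ℕ → Γ := TopologicalSpace.denseSeq Γ
  choose f c hf hfC hfz using fun j => exists_half_infDist_le hconv (z j : H) hCne
  have hfle : ∀ j (a b : H), f j a - f j b ≤ dist a b := fun j a b => by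
    rw [← map_sub, dist_eq_norm]
    exact (le_abs_self _).trans (((f j).le_of_opNorm_le (hf j) _).trans (one_mul _).le)
  have habs : ∀ j, ∀ x ∈ Γ, |f j x - c j| ≤ R := by
    intro j x hx
    rw [abs_le]
    constructor
    · have h1 := hfle j (z j) x
      have h2 := hR (z j).2 hx
      have h3 := hfz j
      have h4 : 0 ≤ Metric.infDist (z j : H) C := Metric.infDist_nonneg
      linarith
    · have h1 := hfle j x p
      have h2 := hR hx hpΓ
      have h3 := hfC j p hpC
      linarith
  refine ⟨f, c, R, hf, hfC, habs,
    fun x hx => (Metric.infDist_le_dist_of_mem hpC).trans (hR hx hpΓ), fun ε hε => ?_⟩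
  obtain ⟨t, htΓ, htfin, ht⟩ := Metric.totallyBounded_iff.1 hΓ (ε / 16) (by positivity) |>.imp
    (fun t ht => show t ⊆ Set.univ ∧ t.Finite ∧ _ from ⟨Set.subset_univ _, ht⟩)
  -- finitely many terms of the dense sequence form a net
  obtain ⟨m, hm⟩ : ∃ m : ℕ, ∀ x ∈ Γ, ∃ j ≤ m, dist x (z j : H) < ε / 8 := by
    -- The centres in `t` may lie outside `Γ`, so each ball that meets `Γ` is represented by a
    -- nearby term of the dense sequence, at the cost of doubling the radius.
    have key : ∀ y ∈ t, ∃ j : ℕ, ∀ x ∈ Γ, dist x y < ε / 16 → dist x (z j : H) < ε / 8 := by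
      intro y _
      by_cases hy : ∃ x ∈ Γ, dist x y < ε / 16
      · obtain ⟨x, hx, hxy⟩ := hy
        obtain ⟨j, hj⟩ := (TopologicalSpace.denseRange_denseSeq Γ).exists_mem_open
          (Metric.isOpen_ball (x := (⟨x, hx⟩ : Γ)) (ε := ε / 16 - dist x y))
          ⟨⟨x, hx⟩, Metric.mem_ball_self (by linarith)⟩
        refine ⟨j, fun x' _ hx'y => ?_⟩
        have h1 : dist (z j : H) x < ε / 16 - dist x y := hj
        have h2 := dist_triangle4 x' y x (z j : H)
        rw [dist_comm y x, dist_comm x (z j : H)] at h2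
        linarith
      · push Not at hy
        exact ⟨0, fun x hx hxy => absurd hxy (not_lt.2 (hy x hx))⟩
    choose! k hk using key
    obtain ⟨m, hm⟩ := (htfin.image k).bddAbove
    refine ⟨m, fun x hx => ?_⟩
    obtain ⟨y, hy, hxy⟩ := Set.mem_iUnion₂.1 (ht hx)
    exact ⟨k y, hm (Set.mem_image_of_mem k hy), hk y hy x hx hxy⟩
  -- If $d(x,C)>\varepsilon$ and $z_j$ is within $\varepsilon/8$ of $x$, the excess at $x$ is at
  -- least $\frac12(\varepsilon-\varepsilon/8)-\varepsilon/8\ge\varepsilon/4$; the weight of the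
  -- $j$-th term is at least $2^{-m}$.
  refine ⟨(1 / 2) ^ m * (ε / 4) ^ 2, by positivity, fun x hx hpot => ?_⟩
  by_contra! hlt
  obtain ⟨j, hjm, hj⟩ := hm x hx
  have h1 : ε / 4 ≤ f j x - c j := by
    have h2 := hfle j (z j) x
    rw [dist_comm] at h2
    have h3 := hfz j
    have h4 := Metric.infDist_le_infDist_add_dist (s := C) (x := x) (y := (z j : H))
    linarith
  refine absurd hpot (not_lt.2 ((?_ : _ ≤ _).trans (le_potential (fun j => habs j x hx) j)))
  have h5 : ((1 : ℝ) / 2) ^ m ≤ (1 / 2) ^ j :=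
    pow_le_pow_of_le_one (by norm_num) (by norm_num) hjm
  have h6 : ε / 4 ≤ max (f j x - c j) 0 := h1.trans (le_max_left _ _)
  gcongr

/-! ### The response of the player -/

section Biaffine

variable {E F : Type*} [AddCommGroup E] [Module ℝ E] [AddCommGroup F] [Module ℝ F]
  {K : Set E} {L : Set F} {g : E → F → H}

theorem IsBiaffineOn.convexOn_left (hg : IsBiaffineOn K L g) (hK : Convex ℝ K) (φ : H →L[ℝ] ℝ)
    {y : F} (hy : y ∈ L) : ConvexOn ℝ K fun x => φ (g x y) :=
  ⟨hK, fun x hx x' hx' s t hs ht hst => by simp [hg.1 x hx x' hx' y hy s t hs ht hst]⟩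

theorem IsBiaffineOn.concaveOn_left (hg : IsBiaffineOn K L g) (hK : Convex ℝ K) (φ : H →L[ℝ] ℝ)
    {y : F} (hy : y ∈ L) : ConcaveOn ℝ K fun x => φ (g x y) :=
  ⟨hK, fun x hx x' hx' s t hs ht hst => by simp [hg.1 x hx x' hx' y hy s t hs ht hst]⟩

theorem IsBiaffineOn.concaveOn_right (hg : IsBiaffineOn K L g) (hL : Convex ℝ L) (φ : H →L[ℝ] ℝ)
    {x : E} (hx : x ∈ K) : ConcaveOn ℝ L fun y => φ (g x y) :=
  ⟨hL, fun y hy y' hy' s t hs ht hst => by simp [hg.2 x hx y hy y' hy' s t hs ht hst]⟩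

end Biaffine

variable {E F : Type*} [AddCommGroup E] [Module ℝ E] [TopologicalSpace E]
  [IsTopologicalAddGroup E] [ContinuousSMul ℝ E] [AddCommGroup F] [Module ℝ F] [TopologicalSpace F]
  [IsTopologicalAddGroup F] [ContinuousSMul ℝ F]
  {K : Set E} {L : Set F} {g : E → F → H} {Γ C : Set H} {f : ℕ → H →L[ℝ] ℝ} {c : ℕ → ℝ} {R : ℝ}

/-- On the set where the test family is bounded, the coupling is a continuous affine function. -/
theorem IsTestFamily.coupling_eq (hf : IsTestFamily Γ C f c R) (hΓ : Γ.Nonempty) {s : ℕ → ℝ} {S : ℝ}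
    (hs : ∀ j, |s j| ≤ S) : ∃ (φ : H →L[ℝ] ℝ) (e : ℝ), ∀ z ∈ Γ,
      coupling s (fun j => f j z - c j) = φ z - e := by
  obtain ⟨p, hp⟩ := hΓ
  have hsum : Summable fun j => ((1 / 2 : ℝ) ^ j * max (s j) 0) • f j := by
    refine Summable.of_norm_bounded (g := fun j => (1 / 2 : ℝ) ^ j * S)
      (summable_geometric_two.mul_right _) fun j => ?_
    have h0 : 0 ≤ max (s j) 0 := le_max_right _ _
    have h1 := max_zero_le_of_abs_le (hs j)
    have h2 : 0 ≤ S := h0.trans h1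
    rw [norm_smul, norm_mul, Real.norm_of_nonneg h0, Real.norm_of_nonneg (by positivity)]
    calc (1 / 2 : ℝ) ^ j * max (s j) 0 * ‖f j‖ ≤ (1 / 2 : ℝ) ^ j * S * 1 := by
          gcongr
          exact hf.norm_le j
      _ = _ := mul_one _
  have happ : ∀ z : H, HasSum (fun j => (1 / 2 : ℝ) ^ j * max (s j) 0 * f j z)
      ((∑' j, ((1 / 2 : ℝ) ^ j * max (s j) 0) • f j) z) := fun z => by
    have := (ContinuousLinearMap.apply ℝ ℝ z).hasSum hsum.hasSum
    simpa using this
  -- The series of functionals converges absolutely in the dual, which is complete even if `H` is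
  -- not. The additive constant is read off at the reference point `p`, so the weighted series of
  -- the `c j` needs no separate treatment.
  refine ⟨∑' j, ((1 / 2 : ℝ) ^ j * max (s j) 0) • f j,
    (∑' j, ((1 / 2 : ℝ) ^ j * max (s j) 0) • f j) p - coupling s (fun j => f j p - c j),
    fun z hz => ?_⟩
  have h1 := (summable_coupling hs fun j => hf.abs_le j z hz).hasSum
  have h2 := (summable_coupling hs fun j => hf.abs_le j p hp).hasSum
  have h3 := h1.sub (h2.add ((happ z).sub (happ p)))
  have h4 : (fun j => (1 / 2 : ℝ) ^ j * max (s j) 0 * (f j z - c j) -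
      ((1 / 2 : ℝ) ^ j * max (s j) 0 * (f j p - c j) + ((1 / 2 : ℝ) ^ j * max (s j) 0 * f j z -
        (1 / 2 : ℝ) ^ j * max (s j) 0 * f j p))) = fun _ => 0 := by
    funext j; ring
  rw [h4] at h3
  have h5 := h3.unique hasSum_zero
  change coupling s _ - (coupling s _ + _) = 0 at h5
  linarith

/-- At a saddle point `(a, b)`, the payoff of `a` against any `y` is, in the direction `φ`, at most
that of any `x` against `b`. Choosing `x` to be the answer to `b` in `C` bounds it by a value at a
point of `C`, where every excess is nonpositive. -/
theorem IsTestFamily.exists_coupling_nonpos (hf : IsTestFamily Γ C f c R)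
    (hgΓ : ∀ x ∈ K, ∀ y ∈ L, g x y ∈ Γ)
    (hKne : K.Nonempty) (hK : IsCompact K) (hKc : Convex ℝ K)
    (hLne : L.Nonempty) (hL : IsCompact L) (hLc : Convex ℝ L) (hg : IsBiaffineOn K L g)
    (hgc : ContinuousOn (Function.uncurry g) (K ×ˢ L))
    (hresp : ∀ y ∈ L, ∃ x ∈ K, g x y ∈ C) {s : ℕ → ℝ} {S : ℝ} (hs : ∀ j, |s j| ≤ S) :
    ∃ x ∈ K, ∀ y ∈ L, coupling s (fun j => f j (g x y) - c j) ≤ 0 := by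
  have hΓne : Γ.Nonempty := by
    obtain ⟨x, hx⟩ := hKne
    obtain ⟨y, hy⟩ := hLne
    exact ⟨_, hgΓ x hx y hy⟩
  obtain ⟨φ, e, hφ⟩ := hf.coupling_eq hΓne hs
  have hcl : ∀ y ∈ L, ContinuousOn (fun x => φ (g x y)) K := fun y hy =>
    φ.continuous.comp_continuousOn (hgc.uncurry_right y hy)
  have hcr : ∀ x ∈ K, ContinuousOn (fun y => φ (g x y)) L := fun x hx =>
    φ.continuous.comp_continuousOn (hgc.uncurry_left x hx)
  obtain ⟨a, ha, b, hb, hab⟩ := Sion.exists_isSaddlePointOn (X := K) (Y := L)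
    (f := fun x y => φ (g x y)) hKne hKc hK
    (fun y hy => (hcl y hy).lowerSemicontinuousOn)
    (fun y hy => (hg.convexOn_left hKc φ hy).quasiconvexOn) hLc hLne hL
    (fun x hx => (hcr x hx).upperSemicontinuousOn)
    (fun x hx => (hg.concaveOn_right hLc φ hx).quasiconcaveOn)
  refine ⟨a, ha, fun y hy => ?_⟩
  obtain ⟨x, hx, hxC⟩ := hresp b hb
  have h1 : φ (g a y) ≤ φ (g x b) := hab x hx y hy
  have h2 : coupling s (fun j => f j (g x b) - c j) ≤ 0 := tsum_nonpos fun j =>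
    mul_nonpos_of_nonneg_of_nonpos (by positivity) (sub_nonpos.2 (hf.le_of_mem j _ hxC))
  rw [hφ _ (hgΓ x hx b hb)] at h2
  rw [hφ _ (hgΓ a ha y hy)]
  linarith

end TestFamily

/-! ### The law of a play -/

/-- The first `n` entries of an infinite history. -/
def past {X : Type*} (n : ℕ) (h : ℕ → X) : Fin n → X := fun i => h i

theorem past_succ {X : Type*} (n : ℕ) (h : ℕ → X) :
    past (n + 1) h = Fin.snoc (α := fun _ => X) (past n h) (h n) := by
  funext i
  refine Fin.lastCases ?_ (fun i => ?_) i <;> simp [past]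

theorem measurable_past {X : Type*} [MeasurableSpace X] (n : ℕ) :
    Measurable (past n : (ℕ → X) → Fin n → X) :=
  measurable_pi_lambda _ fun _ => measurable_pi_apply _

theorem measurable_snoc {X : Type*} [MeasurableSpace X] (n : ℕ) :
    Measurable fun p : (Fin n → X) × X => (Fin.snoc (α := fun _ => X) p.1 p.2 : Fin (n + 1) → X) :=
  measurable_pi_lambda _ fun i => by
    refine Fin.lastCases ?_ (fun i => ?_) i
    · simpa using measurable_snd
    · simp only [Fin.snoc_castSucc]
      exact (measurable_pi_apply i).comp measurable_fst

section Law

variable {A B : Type*} [MeasurableSpace A] [MeasurableSpace B]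
  (σ : Strategy A B A) (τ : Strategy A B B)

theorem law_map_eval_zero : (law σ τ).map (fun h => h 0) = stageKernel σ τ 0 Fin.elim0 := by
  have h1 : (law σ τ).map (Preorder.frestrictLe (π := fun _ => A × B) 0) =
      (stageKernel σ τ 0 Fin.elim0).map
        (MeasurableEquiv.piUnique (fun _ : Finset.Iic 0 => A × B)).symm := by
    rw [law, Kernel.trajMeasure, Measure.map_comp _ _ (by fun_prop), Kernel.traj_map_frestrictLe,
      Kernel.partialTraj_self, Measure.id_comp]
  have h2 : (fun h : ℕ → A × B => h 0) =
      (fun x : (i : Finset.Iic 0) → A × B => x ⟨0, by simp⟩) ∘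
        Preorder.frestrictLe (π := fun _ => A × B) 0 := rfl
  rw [h2, ← Measure.map_map (by fun_prop) (by fun_prop), h1,
    Measure.map_map (by fun_prop) (by fun_prop)]
  convert! Measure.map_id

/-- The law of the actions of stage `n + 1` given the past. -/
theorem lintegral_law_past (n : ℕ) {F : (Fin n → A × B) → A × B → ℝ≥0∞}
    (hF : Measurable (Function.uncurry F)) :
    ∫⁻ h, F (past n h) (h n) ∂(law σ τ) =
      ∫⁻ h, ∫⁻ p, F (past n h) p ∂(stageKernel σ τ n (past n h)) ∂(law σ τ) := by
  cases n with
  | zero =>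
    have h0 : ∀ x : Fin 0 → A × B, x = Fin.elim0 := fun x => Subsingleton.elim _ _
    simp_rw [h0 (past 0 _)]
    have hF0 : Measurable (F Fin.elim0) := hF.comp measurable_prodMk_left
    rw [lintegral_const, measure_univ, mul_one, ← law_map_eval_zero σ τ,
      lintegral_map hF0 (measurable_pi_apply 0)]
  | succ n =>
    have hm := Kernel.map_frestrictLe_trajMeasure_compProd_eq_map_trajMeasure
      (X := fun _ => A × B) (κ := nextKernel σ τ) (μ₀ := stageKernel σ τ 0 Fin.elim0) (a := n)
    have hG : Measurable fun q : ((i : Finset.Iic n) → A × B) × (A × B) =>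
        F (toHistory n q.1) q.2 :=
      hF.comp (((measurable_toHistory n).comp measurable_fst).prodMk measurable_snd)
    calc ∫⁻ h, F (past (n + 1) h) (h (n + 1)) ∂(law σ τ)
        = ∫⁻ q, F (toHistory n q.1) q.2 ∂((law σ τ).map
            (fun h => (Preorder.frestrictLe (π := fun _ => A × B) n h, h (n + 1)))) := by
          rw [lintegral_map hG (by fun_prop)]
          rfl
      _ = ∫⁻ x, ∫⁻ p, F (toHistory n x) p ∂(nextKernel σ τ n x)
            ∂((law σ τ).map (Preorder.frestrictLe (π := fun _ => A × B) n)) := by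
          rw [law, ← hm, Measure.lintegral_compProd hG]
      _ = _ := by
          rw [lintegral_map (Measurable.lintegral_kernel_prod_right' hG) (by fun_prop)]
          rfl

variable {σ τ}

/-- A maximal inequality for nonnegative supermartingales. -/
theorem mul_law_exists_le {Z : ∀ n, (Fin n → A × B) → ℝ≥0∞} (hZ : ∀ n, Measurable (Z n)) {N : ℕ}
    (hsuper : ∀ n ≥ N, ∀ x : Fin n → A × B,
      ∫⁻ p, Z (n + 1) (Fin.snoc (α := fun _ => A × B) x p) ∂(stageKernel σ τ n x) ≤ Z n x)
    (η : ℝ≥0∞) :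
    η * law σ τ {h | ∃ n ≥ N, η ≤ Z n (past n h)} ≤ ∫⁻ h, Z N (past N h) ∂(law σ τ) := by
  classical
  -- the event that the level `η` has been reached at a time in `[N, n]`
  let T : ∀ n, Set (Fin n → A × B) := fun n =>
    {x | ∃ k, ∃ hk : k ≤ n, N ≤ k ∧ η ≤ Z k (fun i => x (Fin.castLE hk i))}
  have hT : ∀ n, MeasurableSet (T n) := fun n => by
    have : T n = ⋃ k, ⋃ hk : k ≤ n, ⋃ _ : N ≤ k,
        {x | η ≤ Z k (fun i => x (Fin.castLE hk i))} := by
      ext x; simp [T]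
    rw [this]
    refine .iUnion fun k => .iUnion fun hk => .iUnion fun _ => measurableSet_le measurable_const
      ((hZ k).comp (measurable_pi_lambda _ fun _ => measurable_pi_apply _))
  have hTpast : ∀ n h, past n h ∈ T n ↔ ∃ k ≤ n, N ≤ k ∧ η ≤ Z k (past k h) := fun n h => by
    exact exists_congr fun k => ⟨fun ⟨h1, h2⟩ => ⟨h1, h2⟩, fun ⟨h1, h2⟩ => ⟨h1, h2⟩⟩
  -- the stopped process
  let Y : ∀ n, (Fin n → A × B) → ℝ≥0∞ := fun n x => if x ∈ T n then η else Z n x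
  have hY : ∀ n, Measurable (Y n) := fun n => Measurable.ite (hT n) measurable_const (hZ n)
  have hstep : ∀ n ≥ N, ∫⁻ h, Y (n + 1) (past (n + 1) h) ∂(law σ τ) ≤
      ∫⁻ h, Y n (past n h) ∂(law σ τ) := by
    intro n hn
    -- Outside `T n` the level can only be reached at time `n + 1` itself, and then the stopped
    -- value `η` is at most `Z (n + 1)`. Hence `G` dominates the stopped process one step later.
    let G : (Fin n → A × B) → A × B → ℝ≥0∞ := fun x p =>
      if x ∈ T n then η else Z (n + 1) (Fin.snoc (α := fun _ => A × B) x p)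
    have hG : Measurable (Function.uncurry G) :=
      Measurable.ite (measurable_fst (hT n)) measurable_const ((hZ _).comp (measurable_snoc n))
    calc ∫⁻ h, Y (n + 1) (past (n + 1) h) ∂(law σ τ) ≤ ∫⁻ h, G (past n h) (h n) ∂(law σ τ) := by
          refine lintegral_mono fun h => ?_
          simp only [Y, G, ← past_succ]
          by_cases h1 : past n h ∈ T n
          · obtain ⟨k, hk, h2⟩ := (hTpast n h).1 h1
            rw [if_pos h1, if_pos ((hTpast _ _).2 ⟨k, hk.trans n.le_succ, h2⟩)]
          · rw [if_neg h1]
            split_ifs with h2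
            · obtain ⟨k, hk, hNk, hle⟩ := (hTpast _ _).1 h2
              obtain rfl : k = n + 1 := by
                by_contra hne
                exact h1 ((hTpast _ _).2 ⟨k, by omega, hNk, hle⟩)
              exact hle
            · exact le_rfl
      _ = _ := lintegral_law_past σ τ n hG
      _ ≤ _ := by
          refine lintegral_mono fun h => ?_
          simp only [Y, G]
          split_ifs
          · simp
          · exact hsuper n hn _
  have hbound : ∀ n ≥ N, ∫⁻ h, Y n (past n h) ∂(law σ τ) ≤ ∫⁻ h, Z N (past N h) ∂(law σ τ) := by
    intro n hn
    induction n, hn using Nat.le_induction with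
    | base =>
      refine lintegral_mono fun h => ?_
      simp only [Y]
      split_ifs with h1
      · obtain ⟨k, hk, hNk, hle⟩ := (hTpast _ _).1 h1
        obtain rfl := le_antisymm hk hNk
        exact hle
      · exact le_rfl
    | succ n hn ih => exact (hstep n hn).trans ih
  have hev : ∀ n ≥ N, η * law σ τ {h | past n h ∈ T n} ≤ ∫⁻ h, Z N (past N h) ∂(law σ τ) := by
    intro n hn
    refine le_trans ?_ (hbound n hn)
    have hms : MeasurableSet {h : ℕ → A × B | past n h ∈ T n} := measurable_past n (hT n)
    rw [← lintegral_indicator_const hms]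
    refine lintegral_mono fun h => ?_
    by_cases h1 : past n h ∈ T n
    · simp [Y, h1]
    · simp [h1]
  have hmono : Monotone fun n => {h : ℕ → A × B | past n h ∈ T n} := by
    intro m n hmn h hh
    obtain ⟨k, hk, h2⟩ := (hTpast _ _).1 hh
    exact (hTpast _ _).2 ⟨k, hk.trans hmn, h2⟩
  have hU : {h : ℕ → A × B | ∃ n ≥ N, η ≤ Z n (past n h)} = ⋃ n, {h | past n h ∈ T n} := by
    ext h
    simp only [Set.mem_ofPred_eq, Set.mem_iUnion, hTpast]
    exact ⟨fun ⟨n, hn, hle⟩ => ⟨n, n, le_rfl, hn, hle⟩, fun ⟨_, k, _, hk, hle⟩ => ⟨k, hk, hle⟩⟩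
  rw [hU, hmono.measure_iUnion, ENNReal.mul_iSup]
  refine iSup_le fun n => ?_
  refine le_trans ?_ (hev (max n N) (le_max_right _ _))
  exact mul_le_mul_right (measure_mono (hmono (le_max_left _ _))) _

end Law

/-! ### From a bound on the coupling to approachability -/

theorem infEDist_eq_ofReal {H : Type*} [PseudoMetricSpace H] {C : Set H} (hC : C.Nonempty)
    (z : H) :
    Metric.infEDist z C = ENNReal.ofReal (Metric.infDist z C) :=
  (ENNReal.ofReal_toReal (Metric.infEDist_ne_top hC)).symm

/-- Independence of the two draws reduces a bound against every mixed action of Nature to a bound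
against each single action `b`. -/
theorem integral_prod_le_of_forall {A B : Type*} [MeasurableSpace A] [MeasurableSpace B]
    {μ : Measure A} {ν : Measure B} [SFinite μ] [IsProbabilityMeasure ν] {Q : A × B → ℝ} {r : ℝ}
    (hQ : Integrable Q (μ.prod ν)) (h : ∀ b, ∫ a, Q (a, b) ∂μ ≤ r) :
    ∫ p, Q p ∂(μ.prod ν) ≤ r := by
  rw [integral_prod_symm _ hQ]
  calc ∫ b, ∫ a, Q (a, b) ∂μ ∂ν ≤ ∫ _, r ∂ν :=
        integral_mono hQ.integral_prod_right (integrable_const _) h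
    _ = r := by simp

section Strategies

variable {A B H : Type*} [NormedAddCommGroup H] [NormedSpace ℝ H] {g : A → B → H} {Γ C : Set H}
  {f : ℕ → H →L[ℝ] ℝ} {c : ℕ → ℝ} {R : ℝ}

/-- The excess of the payoff in the direction of the `j`-th test functional. -/
def excess (g : A → B → H) (f : ℕ → H →L[ℝ] ℝ) (c : ℕ → ℝ) (j : ℕ) (p : A × B) : ℝ :=
  f j (g p.1 p.2) - c j

theorem avgPayoff_mem (hΓ : Convex ℝ Γ) (hg : ∀ a b, g a b ∈ Γ) (h : ℕ → A × B) {n : ℕ}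
    (hn : n ≠ 0) : avgPayoff g h n ∈ Γ := by
  rw [avgPayoff, Finset.smul_sum]
  refine hΓ.sum_mem (fun _ _ => by positivity) ?_ fun m _ => hg _ _
  simp [hn]

theorem potential_avgPayoff (h : ℕ → A × B) {n : ℕ} (hn : n ≠ 0) :
    potential (fun j => f j (avgPayoff g h n) - c j) =
      (n : ℝ)⁻¹ ^ 2 * potential (total (excess g f c) (past n h)) := by
  rw [← potential_smul (by positivity)]
  congr 1 with j
  have hn' : (n : ℝ) ≠ 0 := Nat.cast_ne_zero.2 hn
  have : total (excess g f c) (past n h) j =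
      ∑ m ∈ Finset.range n, (f j (g (h m).1 (h m).2) - c j) := by
    rw [total, Finset.sum_range]
    rfl
  rw [this, avgPayoff, map_smul, map_sum, Finset.sum_sub_distrib, smul_eq_mul, mul_sub]
  simp [hn']

theorem IsTestFamily.nonneg (hf : IsTestFamily Γ C f c R) (hΓ : Γ.Nonempty) : 0 ≤ R := by
  obtain ⟨p, hp⟩ := hΓ
  exact (abs_nonneg _).trans (hf.abs_le 0 p hp)

theorem IsTestFamily.abs_excess_le (hf : IsTestFamily Γ C f c R) (hg : ∀ a b, g a b ∈ Γ) (j : ℕ)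
    (p : A × B) : |excess g f c j p| ≤ R :=
  hf.abs_le j _ (hg _ _)

theorem past_purePlay (σ : PureStrategy A B A) (τ : PureStrategy A B B) (n : ℕ) :
    past n (purePlay σ τ) = pureHistory σ τ n := by
  induction n with
  | zero => exact Subsingleton.elim _ _
  | succ n ih => rw [past_succ, ih]; rfl

theorem purelyApproachable_of_coupling_nonpos (hf : IsTestFamily Γ C f c R) (hC : C.Nonempty)
    (hΓ : Convex ℝ Γ) (hg : ∀ a b, g a b ∈ Γ) (σ : PureStrategy A B A)
    (hσ : ∀ n h b, coupling (total (excess g f c) h) (fun j => excess g f c j (σ n h, b)) ≤ 0) :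
    PurelyApproachable g C := by
  refine ⟨σ, fun ε hε => ?_⟩
  obtain ⟨η, hη, hηε⟩ := hf.infDist_le_of_potential ε hε
  -- The potential of the sums is at most $2R^2n$, hence that of the average at most $2R^2/n$.
  -- Passing to `N + 1` excludes the empty average, which need not lie in `Γ`.
  obtain ⟨N, hN⟩ := exists_nat_gt (2 * R ^ 2 / η)
  refine ⟨N + 1, fun τ n hn => ?_⟩
  have hpot : ∀ k : ℕ, potential (total (excess g f c) (past k (purePlay σ τ))) ≤
      k * (2 * R ^ 2) := by
    intro k
    induction k with
    | zero => simp [potential_total_zero]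
    | succ k ih =>
      rw [past_succ]
      have h1 := potential_snoc_le (hf.abs_excess_le hg) (past k (purePlay σ τ)) (purePlay σ τ k)
      have h2 := hσ k (pureHistory σ τ k) (τ k (pureHistory σ τ k))
      rw [← past_purePlay] at h2
      have h3 : purePlay σ τ k = (σ k (past k (purePlay σ τ)), τ k (past k (purePlay σ τ))) := by
        rw [past_purePlay]
        rfl
      rw [← h3] at h2
      push_cast
      linarith
  have hn0 : n ≠ 0 := by omega
  have hnpos : (0 : ℝ) < n := Nat.cast_pos.2 (Nat.pos_of_ne_zero hn0)
  have hnN : (N : ℝ) ≤ n := Nat.cast_le.2 (by omega)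
  rw [infEDist_eq_ofReal hC]
  refine ENNReal.ofReal_le_ofReal (hηε _ (avgPayoff_mem hΓ hg _ hn0) ?_)
  rw [potential_avgPayoff _ hn0]
  calc (n : ℝ)⁻¹ ^ 2 * potential (total (excess g f c) (past n (purePlay σ τ)))
      ≤ (n : ℝ)⁻¹ ^ 2 * (n * (2 * R ^ 2)) := by gcongr; exact hpot n
    _ = 2 * R ^ 2 / n := by field_simp
    _ < η := by
      rw [div_lt_iff₀ hnpos]
      rw [div_lt_iff₀ hη] at hN
      nlinarith

variable [MeasurableSpace A] [MeasurableSpace B]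

theorem lintegral_potential_snoc_le (hR : ∀ j p, |excess g f c j p| ≤ R)
    (hm : ∀ j, Measurable (excess g f c j)) (σ : Strategy A B A) (τ : Strategy A B B) {n : ℕ}
    (x : Fin n → A × B)
    (hσ : ∀ b, ∫ a, coupling (total (excess g f c) x) (fun j => excess g f c j (a, b))
      ∂(σ.kernel n x) ≤ 1) :
    ∫⁻ p, ENNReal.ofReal
        (potential (total (excess g f c) (Fin.snoc (α := fun _ => A × B) x p)))
        ∂(stageKernel σ τ n x) ≤
      ENNReal.ofReal (potential (total (excess g f c) x) + (2 + 2 * R ^ 2)) := by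
  have := σ.isMarkovKernel n
  have := τ.isMarkovKernel n
  set Q : A × B → ℝ := fun p => coupling (total (excess g f c) x) (fun j => excess g f c j p)
  have hQm : Measurable Q :=
    (measurable_coupling_total hm n).comp (f := fun p : A × B => (x, p)) measurable_prodMk_left
  have hQi : Integrable Q (stageKernel σ τ n x) :=
    Integrable.of_bound hQm.aestronglyMeasurable (2 * (n * R * R)) (.of_forall fun p =>
      abs_coupling_le (abs_total_le hR x) fun j => hR j p)
  have hQ1 : ∫ p, Q p ∂(stageKernel σ τ n x) ≤ 1 := by
    rw [stageKernel, Kernel.prod_apply] at hQi ⊢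
    exact integral_prod_le_of_forall hQi hσ
  set P := potential (total (excess g f c) x)
  have hle : ∀ p, potential (total (excess g f c) (Fin.snoc (α := fun _ => A × B) x p)) ≤
      P + 2 * Q p + 2 * R ^ 2 := fun p => potential_snoc_le hR x p
  have hint' : Integrable (fun p => P + 2 * Q p) (stageKernel σ τ n x) :=
    (integrable_const _).add (hQi.const_mul 2)
  have hint : Integrable (fun p => P + 2 * Q p + 2 * R ^ 2) (stageKernel σ τ n x) :=
    hint'.add (integrable_const _)
  calc _ ≤ ∫⁻ p, ENNReal.ofReal (P + 2 * Q p + 2 * R ^ 2) ∂(stageKernel σ τ n x) :=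
        lintegral_mono fun p => ENNReal.ofReal_le_ofReal (hle p)
    _ = ENNReal.ofReal (∫ p, (P + 2 * Q p + 2 * R ^ 2) ∂(stageKernel σ τ n x)) :=
        (ofReal_integral_eq_lintegral_ofReal hint
          (.of_forall fun p => (potential_nonneg _).trans (hle p))).symm
    _ ≤ _ := by
        refine ENNReal.ofReal_le_ofReal ?_
        rw [integral_add hint' (integrable_const _), integral_add (integrable_const _)
          (hQi.const_mul 2), integral_const_mul]
        simp
        linarith

theorem lintegral_potential_past_le (hR : ∀ j p, |excess g f c j p| ≤ R)
    (hm : ∀ j, Measurable (excess g f c j)) (σ : Strategy A B A) (τ : Strategy A B B)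
    (hσ : ∀ n x b, ∫ a, coupling (total (excess g f c) x) (fun j => excess g f c j (a, b))
      ∂(σ.kernel n x) ≤ 1) (n : ℕ) :
    ∫⁻ h, ENNReal.ofReal (potential (total (excess g f c) (past n h))) ∂(law σ τ) ≤
      ENNReal.ofReal (n * (2 + 2 * R ^ 2)) := by
  induction n with
  | zero => simp [potential_total_zero]
  | succ n ih =>
    simp_rw [past_succ]
    rw [lintegral_law_past σ τ n (F := fun x p => ENNReal.ofReal
      (potential (total (excess g f c) (Fin.snoc (α := fun _ => A × B) x p))))
      (((measurable_potential_total hm _).comp (measurable_snoc n)).ennreal_ofReal)]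
    calc _ ≤ ∫⁻ h, (ENNReal.ofReal (potential (total (excess g f c) (past n h))) +
            ENNReal.ofReal (2 + 2 * R ^ 2)) ∂(law σ τ) := by
          refine lintegral_mono fun h => ?_
          rw [← ENNReal.ofReal_add (potential_nonneg _) (by positivity)]
          exact lintegral_potential_snoc_le hR hm σ τ _ (hσ n _)
      _ ≤ ENNReal.ofReal (n * (2 + 2 * R ^ 2)) + ENNReal.ofReal (2 + 2 * R ^ 2) := by
          rw [lintegral_add_right _ measurable_const, lintegral_const, measure_univ, mul_one]
          gcongr
      _ = _ := by
          rw [← ENNReal.ofReal_add (by positivity) (by positivity)]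
          push_cast
          ring_nf

theorem approachable_of_coupling_le (hf : IsTestFamily Γ C f c R) (hC : C.Nonempty)
    (hΓne : Γ.Nonempty) (hΓ : Convex ℝ Γ) (hg : ∀ a b, g a b ∈ Γ)
    (hm : ∀ j, Measurable (excess g f c j)) (σ : Strategy A B A)
    (hσ : ∀ n x b, ∫ a, coupling (total (excess g f c) x) (fun j => excess g f c j (a, b))
      ∂(σ.kernel n x) ≤ 1) :
    Approachable g C := by
  have hR := hf.abs_excess_le hg
  have hR0 := hf.nonneg hΓne
  refine ⟨σ, fun ε hε => ?_⟩
  obtain ⟨η, hη, hηε⟩ := hf.infDist_le_of_potential (ε / 2) (half_pos hε)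
  -- `M` bounds the expected growth of the potential per stage: twice the tolerance 1, plus $2R^2$.
  set M := 2 + 2 * R ^ 2 with hM
  have hM0 : 0 < M := by positivity
  obtain ⟨N', hN'⟩ := exists_nat_gt (2 * (R + 1) * M / (η * ε))
  -- The factor `R + 1` lets one `N` serve twice: $RM/(\eta N)\le\varepsilon/2$ for the expectation
  -- and $2M/N\le\eta\varepsilon$ for the probability.
  obtain ⟨N, hN1, hN⟩ : ∃ N : ℕ, 1 ≤ N ∧ 2 * (R + 1) * M ≤ N * (η * ε) := by
    refine ⟨N' + 1, by omega, ?_⟩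
    rw [div_lt_iff₀ (by positivity)] at hN'
    push_cast
    nlinarith [mul_pos hη hε]
  refine ⟨N, fun τ => ?_⟩
  set D : ∀ n, (Fin n → A × B) → ℝ := fun n x => potential (total (excess g f c) x) with hD
  have hD0 : ∀ n x, 0 ≤ D n x := fun n x => potential_nonneg _
  have hED : ∀ n, ∫⁻ h, ENNReal.ofReal (D n (past n h)) ∂(law σ τ) ≤ ENNReal.ofReal (n * M) :=
    lintegral_potential_past_le hR hm σ τ hσ
  have hDm : ∀ n, Measurable fun x => ENNReal.ofReal (D n x) := fun n =>
    (measurable_potential_total hm n).ennreal_ofReal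
  have hsmall : ∀ n ≥ N, ∀ h : ℕ → A × B, (n : ℝ)⁻¹ ^ 2 * D n (past n h) < η →
      Metric.infDist (avgPayoff g h n) C ≤ ε / 2 := fun n hn h hlt => by
    have hn0 : n ≠ 0 := by omega
    exact hηε _ (avgPayoff_mem hΓ hg h hn0) (by rwa [potential_avgPayoff h hn0])
  constructor
  · refine iSup₂_le fun n hn => ?_
    have hn0 : n ≠ 0 := by omega
    have hnpos : (0 : ℝ) < n := Nat.cast_pos.2 (Nat.pos_of_ne_zero hn0)
    have hnN : (N : ℝ) ≤ n := Nat.cast_le.2 hn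
    -- A pointwise Markov bound: either the potential is below `η` and the distance at most `ε / 2`,
    -- or the distance is at most `R`, hence at most `R / η` times the potential.
    have hpt : ∀ h : ℕ → A × B, Metric.infEDist (avgPayoff g h n) C ≤
        ENNReal.ofReal (ε / 2) +
          ENNReal.ofReal (R / η * (n : ℝ)⁻¹ ^ 2) * ENNReal.ofReal (D n (past n h)) := by
      intro h
      have h0 := hD0 n (past n h)
      rw [infEDist_eq_ofReal hC, ← ENNReal.ofReal_mul (by positivity),
        ← ENNReal.ofReal_add (by positivity) (by positivity)]
      refine ENNReal.ofReal_le_ofReal ?_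
      rcases lt_or_ge ((n : ℝ)⁻¹ ^ 2 * D n (past n h)) η with hlt | hge
      · exact (hsmall n hn h hlt).trans (le_add_of_nonneg_right (by positivity))
      · refine (hf.infDist_le _ (avgPayoff_mem hΓ hg h hn0)).trans
          (le_add_of_nonneg_of_le (by positivity) ?_)
        calc R = R / η * η := by field_simp
          _ ≤ R / η * ((n : ℝ)⁻¹ ^ 2 * D n (past n h)) := by gcongr
          _ = _ := by ring
    calc ∫⁻ h, Metric.infEDist (avgPayoff g h n) C ∂(law σ τ)
        ≤ ∫⁻ h, (ENNReal.ofReal (ε / 2) + ENNReal.ofReal (R / η * (n : ℝ)⁻¹ ^ 2) *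
            ENNReal.ofReal (D n (past n h))) ∂(law σ τ) := lintegral_mono hpt
      _ ≤ ENNReal.ofReal (ε / 2) + ENNReal.ofReal (R / η * (n : ℝ)⁻¹ ^ 2) *
            ENNReal.ofReal (n * M) := by
          rw [lintegral_add_left measurable_const, lintegral_const, measure_univ, mul_one,
            lintegral_const_mul' _ _ ENNReal.ofReal_ne_top]
          gcongr
          exact hED n
      _ ≤ ENNReal.ofReal ε := by
          rw [← ENNReal.ofReal_mul (by positivity),
            ← ENNReal.ofReal_add (by positivity) (by positivity)]
          refine ENNReal.ofReal_le_ofReal ?_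
          have h1 : R / η * (n : ℝ)⁻¹ ^ 2 * (n * M) = R * M / (η * n) := by field_simp
          have h2 : R * M / (η * n) ≤ ε / 2 := by
            rw [div_le_iff₀ (by positivity)]
            have : (N : ℝ) * (η * ε) ≤ n * (η * ε) := by gcongr
            nlinarith
          rw [h1]
          linarith
  -- The term $M/n$ compensates the drift and makes `Z` a supermartingale: $M/(n+1)^2+M/(n+1)\le
  -- M/n$, that is, $n(n+2)\le(n+1)^2$.
  · let Z : ∀ n, (Fin n → A × B) → ℝ≥0∞ := fun n x =>
      ENNReal.ofReal ((n : ℝ)⁻¹ ^ 2) * ENNReal.ofReal (D n x) + ENNReal.ofReal (M / n)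
    have hZm : ∀ n, Measurable (Z n) := fun n => ((hDm n).const_mul _).add_const _
    have hsuper : ∀ n ≥ N, ∀ x : Fin n → A × B,
        ∫⁻ p, Z (n + 1) (Fin.snoc (α := fun _ => A × B) x p) ∂(stageKernel σ τ n x) ≤ Z n x := by
      intro n hn x
      have hnpos : (0 : ℝ) < n := Nat.cast_pos.2 (by omega)
      have h0 := hD0 n x
      calc _ = ENNReal.ofReal (((n + 1 : ℕ) : ℝ)⁻¹ ^ 2) *
            ∫⁻ p, ENNReal.ofReal (D (n + 1) (Fin.snoc (α := fun _ => A × B) x p))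
              ∂(stageKernel σ τ n x) + ENNReal.ofReal (M / (n + 1 : ℕ)) := by
            simp only [Z]
            rw [lintegral_add_right _ measurable_const, lintegral_const, measure_univ, mul_one,
              lintegral_const_mul' _ _ ENNReal.ofReal_ne_top]
        _ ≤ ENNReal.ofReal (((n + 1 : ℕ) : ℝ)⁻¹ ^ 2) * ENNReal.ofReal (D n x + M) +
            ENNReal.ofReal (M / (n + 1 : ℕ)) := by
            gcongr
            exact lintegral_potential_snoc_le hR hm σ τ x (hσ n x)
        _ ≤ Z n x := by
            simp only [Z]
            rw [← ENNReal.ofReal_mul (by positivity), ← ENNReal.ofReal_mul (by positivity),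
              ← ENNReal.ofReal_add (by positivity) (by positivity),
              ← ENNReal.ofReal_add (by positivity) (by positivity)]
            refine ENNReal.ofReal_le_ofReal ?_
            have h1 : ((n + 1 : ℕ) : ℝ)⁻¹ ^ 2 * D n x ≤ (n : ℝ)⁻¹ ^ 2 * D n x := by
              gcongr
              simp
            have h2 : ((n + 1 : ℕ) : ℝ)⁻¹ ^ 2 * M + M / (n + 1 : ℕ) ≤ M / n := by
              push_cast
              have : ((n : ℝ) + 1)⁻¹ ^ 2 * M + M / (n + 1) = M * (n + 2) / (n + 1) ^ 2 := by
                field_simp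
                ring
              rw [this, div_le_div_iff₀ (by positivity) hnpos]
              nlinarith
            linarith
    have hmax := mul_law_exists_le hZm hsuper (ENNReal.ofReal η)
    have hsub : {h | ENNReal.ofReal ε ≤ ⨆ n ≥ N, Metric.infEDist (avgPayoff g h n) C} ⊆
        {h | ∃ n ≥ N, ENNReal.ofReal η ≤ Z n (past n h)} := by
      intro h hh
      by_contra hcon
      simp only [Set.mem_ofPred_eq, not_exists, not_and, not_le] at hcon
      -- The margin `ε / 2` is needed because a supremum of values below `ε` could still equal `ε`.
      refine absurd (Set.mem_ofPred_eq ▸ hh) (not_le.2 (lt_of_le_of_lt (b := ENNReal.ofReal (ε / 2))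
        (iSup₂_le fun n hn => ?_) ((ENNReal.ofReal_lt_ofReal_iff hε).2 (half_lt_self hε))))
      rw [infEDist_eq_ofReal hC]
      refine ENNReal.ofReal_le_ofReal (hsmall n hn h ?_)
      have h1 := lt_of_le_of_lt le_self_add (hcon n hn)
      rw [← ENNReal.ofReal_mul (by positivity)] at h1
      exact (ENNReal.ofReal_lt_ofReal_iff hη).1 h1
    refine (measure_mono hsub).trans ?_
    have hNpos : (0 : ℝ) < N := Nat.cast_pos.2 hN1
    have hEZ : ∫⁻ h, Z N (past N h) ∂(law σ τ) ≤ ENNReal.ofReal η * ENNReal.ofReal ε := by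
      simp only [Z]
      rw [lintegral_add_right _ measurable_const, lintegral_const, measure_univ, mul_one,
        lintegral_const_mul' _ _ ENNReal.ofReal_ne_top]
      refine (add_le_add_left (mul_le_mul_right (hED N) _) _).trans ?_
      rw [← ENNReal.ofReal_mul (by positivity), ← ENNReal.ofReal_mul (by positivity),
        ← ENNReal.ofReal_add (by positivity) (by positivity)]
      refine ENNReal.ofReal_le_ofReal ?_
      have h1 : (N : ℝ)⁻¹ ^ 2 * (N * M) + M / N = 2 * M / N := by field_simp; ring
      rw [h1, div_le_iff₀ hNpos]
      nlinarith [mul_nonneg hR0 hM0.le]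
    exact (ENNReal.mul_le_mul_iff_right (ENNReal.ofReal_pos.2 hη).ne' ENNReal.ofReal_ne_top).1
      (hmax.trans hEZ)

end Strategies

/-! ### Necessity of the condition -/

section Necessity

variable {H : Type*} [NormedAddCommGroup H] [NormedSpace ℝ H] {C : Set H}

/-- If a compact convex set does not meet `C`, then it lies in a half-space that is at a positive
distance from `C`. -/
theorem exists_separating_functional (hC : IsClosed C) (hconv : Convex ℝ C) {S : Set H}
    (hS : IsCompact S) (hSc : Convex ℝ S) (hdisj : Disjoint S C) :
    ∃ (φ : H →L[ℝ] ℝ) (r δ : ℝ), 0 < δ ∧ (∀ z ∈ S, φ z ≤ r) ∧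
      ∀ z, ENNReal.ofReal (r + δ - φ z) ≤ Metric.infEDist z C := by
  obtain ⟨F, r, v, hF, hrv, hCv⟩ := geometric_hahn_banach_compact_closed hSc hS hconv hC hdisj
  have hk : 0 < ‖F‖ + 1 := by positivity
  -- Normalizing by `‖F‖ + 1` makes the functional 1-Lipschitz and also covers `F = 0`, which may
  -- occur when `S` or `C` is empty.
  refine ⟨(‖F‖ + 1)⁻¹ • F, (‖F‖ + 1)⁻¹ * r, (‖F‖ + 1)⁻¹ * (v - r),
    mul_pos (inv_pos.2 hk) (sub_pos.2 hrv), fun z hz => ?_, fun z => ?_⟩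
  · rw [smul_apply, smul_eq_mul]
    exact mul_le_mul_of_nonneg_left (hF z hz).le (inv_pos.2 hk).le
  · refine Metric.le_infEDist.2 fun b hb => ?_
    rw [edist_dist]
    refine ENNReal.ofReal_le_ofReal ?_
    have h1 : F b - F z ≤ ‖F‖ * dist z b := by
      rw [← map_sub, dist_comm, dist_eq_norm]
      exact (le_abs_self _).trans (F.le_opNorm _)
    have h2 := hCv b hb
    have h3 : (0 : ℝ) ≤ dist z b := dist_nonneg
    rw [smul_apply, smul_eq_mul, ← mul_add, ← mul_sub, inv_mul_le_iff₀ hk]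
    linarith

theorem exists_functional_of_forall_notMem {E F : Type*} [AddCommGroup E] [Module ℝ E]
    [TopologicalSpace E] [AddCommGroup F] [Module ℝ F] [TopologicalSpace F] (hC : IsClosed C)
    (hconv : Convex ℝ C) {K : Set E} {L : Set F} {g : E → F → H} (hK : IsCompact K)
    (hKc : Convex ℝ K) (hg : IsBiaffineOn K L g)
    (hgc : ContinuousOn (Function.uncurry g) (K ×ˢ L)) {y : F} (hy : y ∈ L)
    (hgC : ∀ x ∈ K, g x y ∉ C) :
    ∃ (φ : H →L[ℝ] ℝ) (r δ : ℝ), 0 < δ ∧ (∀ x ∈ K, φ (g x y) ≤ r) ∧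
      ∀ z, ENNReal.ofReal (r + δ - φ z) ≤ Metric.infEDist z C := by
  obtain ⟨φ, r, δ, hδ, h1, h2⟩ := exists_separating_functional hC hconv
    (S := (fun x => g x y) '' K) (hK.image_of_continuousOn (hgc.uncurry_right y hy))
    (by
      rintro _ ⟨x, hx, rfl⟩ _ ⟨x', hx', rfl⟩ s t hs ht hst
      exact ⟨s • x + t • x', hKc hx hx' hs ht hst, hg.1 x hx x' hx' y hy s t hs ht hst⟩)
    (Set.disjoint_left.2 (by rintro _ ⟨x, hx, rfl⟩; exact hgC x hx))
  exact ⟨φ, r, δ, hδ, fun x hx => h1 _ ⟨x, hx, rfl⟩, h2⟩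

variable {A B : Type*} {g : A → B → H}

theorem map_avgPayoff (φ : H →L[ℝ] ℝ) (h : ℕ → A × B) (n : ℕ) :
    φ (avgPayoff g h n) = (n : ℝ)⁻¹ * ∑ m ∈ Finset.range n, φ (g (h m).1 (h m).2) := by
  rw [avgPayoff, map_smul, map_sum, smul_eq_mul]

theorem inv_mul_sum_range_le {n : ℕ} (hn : n ≠ 0) {v : ℕ → ℝ} {r : ℝ} (hv : ∀ m, v m ≤ r) :
    (n : ℝ)⁻¹ * ∑ m ∈ Finset.range n, v m ≤ r := by
  have hn' : (0 : ℝ) < n := Nat.cast_pos.2 (Nat.pos_of_ne_zero hn)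
  rw [inv_mul_le_iff₀ hn']
  refine (Finset.sum_le_card_nsmul _ _ r fun m _ => hv m).trans ?_
  simp

theorem not_purelyApproachable {φ : H →L[ℝ] ℝ} {r δ : ℝ} (hδ : 0 < δ)
    (hφ : ∀ z, ENNReal.ofReal (r + δ - φ z) ≤ Metric.infEDist z C) (b : B)
    (hb : ∀ a, φ (g a b) ≤ r) : ¬ PurelyApproachable g C := by
  rintro ⟨σ, hσ⟩
  obtain ⟨N, hN⟩ := hσ (δ / 2) (half_pos hδ)
  have h1 := (hφ _).trans (hN (fun _ _ => b) (N + 1) N.le_succ)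
  rw [ENNReal.ofReal_le_ofReal_iff (half_pos hδ).le, map_avgPayoff] at h1
  have h2 := inv_mul_sum_range_le N.succ_ne_zero
    (v := fun m => φ (g (purePlay σ (fun _ _ => b) m).1 (purePlay σ (fun _ _ => b) m).2))
    (fun m => hb _)
  linarith

variable [MeasurableSpace A] [MeasurableSpace B]

/-- The strategy of drawing the actions independently according to a fixed distribution. -/
def constStrategy (ν : Measure B) [IsProbabilityMeasure ν] : Strategy A B B where
  kernel _ := Kernel.const _ ν
  isMarkovKernel _ := inferInstance

/-- Nature's draw is independent of the player's action given the past, so the bound on the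
`ν`-average for each `a` survives any strategy of the player. -/
theorem integral_law_constStrategy_le {σ : Strategy A B A} {ν : Measure B} [IsProbabilityMeasure ν]
    {ψ : A × B → ℝ} (hψ : Measurable ψ) {R r : ℝ} (hR : ∀ p, |ψ p| ≤ R)
    (hr : ∀ a, ∫ b, ψ (a, b) ∂ν ≤ r) (n : ℕ) :
    ∫ h, ψ (h n) ∂(law σ (constStrategy ν)) ≤ r := by
  set τ : Strategy A B B := constStrategy ν
  have hint : ∀ (μ : Measure (A × B)) [IsProbabilityMeasure μ], Integrable ψ μ := fun μ _ =>
    Integrable.of_bound hψ.aestronglyMeasurable R (.of_forall hR)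
  have hint' : Integrable (fun h => ψ (h n)) (law σ τ) :=
    Integrable.of_bound (hψ.comp (measurable_pi_apply n)).aestronglyMeasurable R
      (.of_forall fun h => hR _)
  -- a shift that makes everything nonnegative
  obtain ⟨k, hk1, hk2⟩ : ∃ k : ℝ, R ≤ k ∧ 0 ≤ r + k :=
    ⟨max R (-r), le_max_left _ _, by linarith [le_max_right R (-r)]⟩
  have hpos : ∀ p, 0 ≤ ψ p + k := fun p => by linarith [neg_le_of_abs_le (hR p)]
  have hstage : ∀ x : Fin n → A × B, ∫ p, ψ p ∂(stageKernel σ τ n x) ≤ r := by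
    intro x
    have := σ.isMarkovKernel n
    have := τ.isMarkovKernel n
    have h1 := hint (stageKernel σ τ n x)
    rw [stageKernel, Kernel.prod_apply] at h1 ⊢
    rw [integral_prod _ h1]
    calc ∫ a, ∫ b, ψ (a, b) ∂(τ.kernel n x) ∂(σ.kernel n x) ≤ ∫ _, r ∂(σ.kernel n x) :=
          integral_mono h1.integral_prod_left (integrable_const _) hr
      _ = r := by simp
  have hle : ENNReal.ofReal (∫ h, ψ (h n) ∂(law σ τ) + k) ≤ ENNReal.ofReal (r + k) := by
    calc ENNReal.ofReal (∫ h, ψ (h n) ∂(law σ τ) + k)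
        = ENNReal.ofReal (∫ h, (ψ (h n) + k) ∂(law σ τ)) := by
          rw [integral_add hint' (integrable_const _)]
          simp
      _ = ∫⁻ h, ENNReal.ofReal (ψ (h n) + k) ∂(law σ τ) :=
          ofReal_integral_eq_lintegral_ofReal (hint'.add (integrable_const _))
            (.of_forall fun h => hpos _)
      _ = ∫⁻ h, ∫⁻ p, ENNReal.ofReal (ψ p + k) ∂(stageKernel σ τ n (past n h)) ∂(law σ τ) :=
          lintegral_law_past σ τ n (F := fun _ p => ENNReal.ofReal (ψ p + k))
            ((hψ.comp measurable_snd).add_const k).ennreal_ofReal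
      _ ≤ ∫⁻ _, ENNReal.ofReal (r + k) ∂(law σ τ) := by
          refine lintegral_mono fun h => ?_
          have hi : Integrable (fun p => ψ p + k) (stageKernel σ τ n (past n h)) :=
            (hint _).add (integrable_const _)
          rw [← ofReal_integral_eq_lintegral_ofReal hi (.of_forall fun p => hpos _),
            integral_add (hint _) (integrable_const _)]
          refine ENNReal.ofReal_le_ofReal ?_
          have := hstage (past n h)
          simpa using this
      _ = _ := by simp
  rw [ENNReal.ofReal_le_ofReal_iff hk2] at hle
  linarith

/-- Against independent draws from `ν`, the expected distance is at least $\mathbb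
E[r+\delta-\varphi(\overline g_n)]\ge\delta$ for all $n\ge 1$. Only the expectation half of
approachability is contradicted. -/
theorem not_approachable {φ : H →L[ℝ] ℝ} {r δ R : ℝ} (hδ : 0 < δ)
    (hφ : ∀ z, ENNReal.ofReal (r + δ - φ z) ≤ Metric.infEDist z C)
    (hm : Measurable fun p : A × B => φ (g p.1 p.2)) (hR : ∀ a b, |φ (g a b)| ≤ R)
    (ν : Measure B) [IsProbabilityMeasure ν] (hν : ∀ a, ∫ b, φ (g a b) ∂ν ≤ r) :
    ¬ Approachable g C := by
  rintro ⟨σ, hσ⟩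
  obtain ⟨N, hN⟩ := hσ (δ / 2) (half_pos hδ)
  have h1 := (le_iSup₂ (f := fun n (_ : n ≥ N) => ∫⁻ h, Metric.infEDist (avgPayoff g h n) C
    ∂(law σ (constStrategy ν))) (N + 1) N.le_succ).trans (hN (constStrategy ν)).1
  have hint : ∀ m, Integrable (fun h : ℕ → A × B => φ (g (h m).1 (h m).2))
      (law σ (constStrategy ν)) := fun m =>
    Integrable.of_bound (hm.comp (measurable_pi_apply m)).aestronglyMeasurable R
      (.of_forall fun h => hR _ _)
  have hint2 : Integrable (fun h => φ (avgPayoff g h (N + 1))) (law σ (constStrategy ν)) := by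
    simp_rw [map_avgPayoff]
    exact (integrable_finsetSum _ fun m _ => hint m).const_mul _
  have h2 : ∫ h, φ (avgPayoff g h (N + 1)) ∂(law σ (constStrategy ν)) ≤ r := by
    simp_rw [map_avgPayoff]
    rw [integral_const_mul, integral_finsetSum _ fun m _ => hint m]
    exact inv_mul_sum_range_le N.succ_ne_zero fun m =>
      integral_law_constStrategy_le hm (fun p => hR p.1 p.2) hν m
  have hint3 : Integrable (fun h => r + δ - φ (avgPayoff g h (N + 1)))
      (law σ (constStrategy ν)) := (integrable_const _).sub hint2
  have h3 : ENNReal.ofReal (∫ h, (r + δ - φ (avgPayoff g h (N + 1))) ∂(law σ (constStrategy ν))) ≤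
      ENNReal.ofReal (δ / 2) := by
    refine le_trans ?_ h1
    calc _ ≤ ENNReal.ofReal (∫ h, max (r + δ - φ (avgPayoff g h (N + 1))) 0
            ∂(law σ (constStrategy ν))) :=
          ENNReal.ofReal_le_ofReal (integral_mono hint3 hint3.pos_part fun h => le_max_left _ _)
      _ = ∫⁻ h, ENNReal.ofReal (max (r + δ - φ (avgPayoff g h (N + 1))) 0)
            ∂(law σ (constStrategy ν)) :=
          ofReal_integral_eq_lintegral_ofReal hint3.pos_part (.of_forall fun h => le_max_right _ _)
      _ ≤ _ := lintegral_mono fun h => by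
          rw [ENNReal.ofReal_max, ENNReal.ofReal_zero, max_eq_left zero_le]
          exact hφ _
  rw [ENNReal.ofReal_le_ofReal_iff (half_pos hδ).le, integral_sub (integrable_const _) hint2] at h3
  simp at h3
  linarith

end Necessity

theorem continuous_subtype {E F H : Type*} [TopologicalSpace E] [TopologicalSpace F]
    [TopologicalSpace H] {K : Set E} {L : Set F} {g : E → F → H}
    (hgc : ContinuousOn (Function.uncurry g) (K ×ˢ L)) :
    Continuous fun p : K × L => g p.1 p.2 :=
  hgc.comp_continuous (f := fun p : K × L => ((p.1 : E), (p.2 : F))) (by fun_prop)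
    fun p => ⟨p.1.2, p.2.2⟩

/-- A compact metrizable set is second countable. -/
theorem secondCountableTopology_of_isCompact {X : Type*} [TopologicalSpace X] {S : Set X}
    (hS : IsCompact S) [TopologicalSpace.MetrizableSpace S] : SecondCountableTopology S := by
  have := isCompact_iff_compactSpace.1 hS
  let _ := TopologicalSpace.metrizableSpaceMetric S
  infer_instance

section Main

variable {H : Type*} [NormedAddCommGroup H] [NormedSpace ℝ H] {C : Set H}

/-! ### Compact convex sets of actions -/

section Compact

variable {E F : Type*} [TopologicalSpace E] [TopologicalSpace F] {K : Set E} {L : Set F}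
  {g : E → F → H}

/-- `Γ` is the convex hull of the payoffs, so that it contains the averages. It is totally bounded,
though possibly not compact when `H` is incomplete. -/
theorem exists_isTestFamily_of_response (hconv : Convex ℝ C) (hK : IsCompact K)
    (hLne : L.Nonempty) (hL : IsCompact L) (hgc : ContinuousOn (Function.uncurry g) (K ×ˢ L))
    (hresp : ∀ y ∈ L, ∃ x ∈ K, g x y ∈ C) :
    ∃ (Γ : Set H) (f : ℕ → H →L[ℝ] ℝ) (c : ℕ → ℝ) (R : ℝ), C.Nonempty ∧ Γ.Nonempty ∧ Convex ℝ Γ ∧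
      (∀ x ∈ K, ∀ y ∈ L, g x y ∈ Γ) ∧ IsTestFamily Γ C f c R := by
  obtain ⟨y, hy⟩ := hLne
  obtain ⟨x, hx, hxC⟩ := hresp y hy
  let Γ := convexHull ℝ (Function.uncurry g '' (K ×ˢ L))
  have hgΓ : ∀ x ∈ K, ∀ y ∈ L, g x y ∈ Γ := fun x hx y hy =>
    subset_convexHull ℝ _ ⟨(x, y), ⟨hx, hy⟩, rfl⟩
  obtain ⟨f, c, R, hf⟩ := exists_isTestFamily (Γ := Γ)
    (totallyBounded_convexHull.2 ((hK.prod hL).image_of_continuousOn hgc).totallyBounded)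
    hconv ⟨_, hxC, hgΓ x hx y hy⟩
  exact ⟨Γ, f, c, R, ⟨_, hxC⟩, ⟨_, hgΓ x hx y hy⟩, convex_convexHull ℝ _, hgΓ, hf⟩

theorem exists_abs_le (hK : IsCompact K) (hL : IsCompact L)
    (hgc : ContinuousOn (Function.uncurry g) (K ×ˢ L)) (φ : H →L[ℝ] ℝ) :
    ∃ R : ℝ, ∀ x ∈ K, ∀ y ∈ L, |φ (g x y)| ≤ R := by
  obtain ⟨R, hR⟩ := (hK.prod hL).exists_bound_of_continuousOn (φ.continuous.comp_continuousOn hgc)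
  exact ⟨R, fun x hx y hy => hR (x, y) ⟨hx, hy⟩⟩

variable [AddCommGroup E] [Module ℝ E] [AddCommGroup F] [Module ℝ F]

theorem exists_response_of_purelyApproachable (hC : IsClosed C) (hconv : Convex ℝ C)
    (hK : IsCompact K) (hKc : Convex ℝ K) (hg : IsBiaffineOn K L g)
    (hgc : ContinuousOn (Function.uncurry g) (K ×ˢ L))
    (h : PurelyApproachable (fun (a : K) (b : L) => g a b) C) (y : F) (hy : y ∈ L) :
    ∃ x ∈ K, g x y ∈ C := by
  by_contra! hcon
  obtain ⟨φ, r, δ, hδ, hr, hφ⟩ :=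
    exists_functional_of_forall_notMem hC hconv hK hKc hg hgc hy hcon
  exact not_purelyApproachable (g := fun (a : K) (b : L) => g a b) hδ hφ (⟨y, hy⟩ : L)
    (fun a => hr a a.2) h

section Borel

variable [MeasurableSpace K] [BorelSpace K] [TopologicalSpace.MetrizableSpace K]
  [MeasurableSpace L] [BorelSpace L] [TopologicalSpace.MetrizableSpace L]

theorem exists_response_of_approachable (hC : IsClosed C) (hconv : Convex ℝ C)
    (hK : IsCompact K) (hKc : Convex ℝ K) (hL : IsCompact L) (hg : IsBiaffineOn K L g)
    (hgc : ContinuousOn (Function.uncurry g) (K ×ˢ L))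
    (h : Approachable (fun (a : K) (b : L) => g a b) C) (y : F) (hy : y ∈ L) :
    ∃ x ∈ K, g x y ∈ C := by
  by_contra! hcon
  obtain ⟨φ, r, δ, hδ, hr, hφ⟩ :=
    exists_functional_of_forall_notMem hC hconv hK hKc hg hgc hy hcon
  obtain ⟨R, hR⟩ := exists_abs_le hK hL hgc φ
  have := secondCountableTopology_of_isCompact hK
  have := secondCountableTopology_of_isCompact hL
  refine not_approachable (g := fun (a : K) (b : L) => g a b) hδ hφ
    (φ.continuous.comp (continuous_subtype hgc)).measurable
    (fun a b => hR a a.2 b b.2) (Measure.dirac (⟨y, hy⟩ : L)) (fun a => ?_) h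
  rw [integral_dirac]
  exact hr a a.2

end Borel

variable [IsTopologicalAddGroup E] [ContinuousSMul ℝ E]
  [IsTopologicalAddGroup F] [ContinuousSMul ℝ F]

theorem purelyApproachable_of_response (hconv : Convex ℝ C)
    (hKne : K.Nonempty) (hK : IsCompact K) (hKc : Convex ℝ K)
    (hLne : L.Nonempty) (hL : IsCompact L) (hLc : Convex ℝ L) (hg : IsBiaffineOn K L g)
    (hgc : ContinuousOn (Function.uncurry g) (K ×ˢ L))
    (hresp : ∀ y ∈ L, ∃ x ∈ K, g x y ∈ C) :
    PurelyApproachable (fun (a : K) (b : L) => g a b) C := by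
  obtain ⟨Γ, f, c, R, hCne, -, hΓ, hgΓ, hf⟩ :=
    exists_isTestFamily_of_response hconv hK hLne hL hgc hresp
  set g' : K → L → H := fun a b => g a b
  have hg'Γ : ∀ a b, g' a b ∈ Γ := fun a b => hgΓ a a.2 b b.2
  have hσ : ∀ (n : ℕ) (h : Fin n → K × L), ∃ a : K, ∀ b : L,
      coupling (total (excess g' f c) h) (fun j => excess g' f c j (a, b)) ≤ 0 := by
    intro n h
    obtain ⟨x, hx, hxy⟩ := hf.exists_coupling_nonpos hgΓ hKne hK hKc hLne hL hLc hg hgc hresp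
      (abs_total_le (hf.abs_excess_le hg'Γ) h)
    exact ⟨⟨x, hx⟩, fun b => hxy b b.2⟩
  choose σ hσ using hσ
  exact purelyApproachable_of_coupling_nonpos hf hCne hΓ hg'Γ σ hσ

theorem approachable_of_response (hconv : Convex ℝ C)
    (hKne : K.Nonempty) (hK : IsCompact K) (hKc : Convex ℝ K)
    (hLne : L.Nonempty) (hL : IsCompact L) (hLc : Convex ℝ L) (hg : IsBiaffineOn K L g)
    (hgc : ContinuousOn (Function.uncurry g) (K ×ˢ L))
    (hresp : ∀ y ∈ L, ∃ x ∈ K, g x y ∈ C)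
    [MeasurableSpace K] [BorelSpace K] [TopologicalSpace.MetrizableSpace K]
    [MeasurableSpace L] [BorelSpace L] [TopologicalSpace.MetrizableSpace L] :
    Approachable (fun (a : K) (b : L) => g a b) C := by
  classical
  obtain ⟨Γ, f, c, R, hCne, hΓne, hΓ, hgΓ, hf⟩ :=
    exists_isTestFamily_of_response hconv hK hLne hL hgc hresp
  have := secondCountableTopology_of_isCompact hK
  have := secondCountableTopology_of_isCompact hL
  have := isCompact_iff_compactSpace.1 hL
  have : Nonempty K := hKne.to_subtype
  have : Nonempty L := hLne.to_subtype
  set g' : K → L → H := fun a b => g a b with hg'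
  have hg'Γ : ∀ a b, g' a b ∈ Γ := fun a b => hgΓ a a.2 b b.2
  have hg'c : Continuous fun p : K × L => g' p.1 p.2 := continuous_subtype hgc
  have hm : ∀ j, Measurable (excess g' f c j) := fun j =>
    (((f j).continuous.comp hg'c).sub continuous_const).measurable
  let Q : ∀ n, (Fin n → K × L) → K × L → ℝ := fun n h p =>
    coupling (total (excess g' f c) h) (fun j => excess g' f c j p)
  have hQc : ∀ n h, Continuous (Q n h) := fun n h => by
    obtain ⟨φ, e, hφ⟩ := hf.coupling_eq hΓne (abs_total_le (hf.abs_excess_le hg'Γ) h)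
    have : Q n h = fun p => φ (g' p.1 p.2) - e := funext fun p => hφ _ (hg'Γ p.1 p.2)
    rw [this]
    exact (φ.continuous.comp hg'c).sub continuous_const
  -- Sion's theorem gives no measurable dependence on the history. Actions with coupling below 1
  -- against all of `L` form a neighbourhood of the optimal one, so some term of a dense sequence
  -- qualifies, and the first such term is a measurable choice.
  let x : ℕ → K := TopologicalSpace.denseSeq K
  have hex : ∀ n (h : Fin n → K × L), ∃ k, ∀ b, Q n h (x k, b) ≤ 1 := by
    intro n h
    obtain ⟨a, ha, hab⟩ := hf.exists_coupling_nonpos hgΓ hKne hK hKc hLne hL hLc hg hgc hresp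
      (abs_total_le (hf.abs_excess_le hg'Γ) h)
    have h1 : ∀ᶠ a' in nhds (⟨a, ha⟩ : K), ∀ b ∈ (Set.univ : Set L), Q n h (a', b) < 1 :=
      isCompact_univ.eventually_forall_of_forall_eventually fun b _ =>
        (hQc n h).continuousAt.eventually_lt continuousAt_const
          ((hab b b.2).trans_lt one_pos)
    obtain ⟨U, hU, hUo, haU⟩ := eventually_nhds_iff.1 h1
    obtain ⟨k, hk⟩ := (TopologicalSpace.denseRange_denseSeq K).exists_mem_open hUo ⟨_, haU⟩
    exact ⟨k, fun b => (hU _ hk b (Set.mem_univ b)).le⟩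
  have hQm : ∀ n k, MeasurableSet {h : Fin n → K × L | ∀ b, Q n h (x k, b) ≤ 1} := by
    intro n k
    -- By continuity in `b`, testing on a countable dense subset of `L` suffices.
    have : {h : Fin n → K × L | ∀ b, Q n h (x k, b) ≤ 1} =
        ⋂ i, {h | Q n h (x k, TopologicalSpace.denseSeq L i) ≤ 1} := by
      ext h
      simp only [Set.mem_ofPred_eq, Set.mem_iInter]
      refine ⟨fun hb i => hb _, fun hi b => ?_⟩
      have hcl : IsClosed {b | Q n h (x k, b) ≤ 1} :=
        isClosed_le ((hQc n h).comp (Continuous.prodMk_right (x k))) continuous_const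
      exact (TopologicalSpace.denseRange_denseSeq L).induction_on (p := fun b => Q n h (x k, b) ≤ 1)
        b hcl hi
    rw [this]
    refine .iInter fun i => measurableSet_le ?_ measurable_const
    exact (measurable_coupling_total hm n).comp
      (f := fun h => (h, (x k, TopologicalSpace.denseSeq L i))) measurable_prodMk_right
  have hσm : ∀ n, Measurable fun h : Fin n → K × L => x (Nat.find (hex n h)) := fun n =>
    (measurable_of_countable x).comp (measurable_find (hex n) (hQm n))
  refine approachable_of_coupling_le hf hCne hΓne hΓ hg'Γ hm
    ⟨fun n => Kernel.deterministic _ (hσm n), fun n => inferInstance⟩ fun n h b => ?_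
  rw [Kernel.integral_deterministic]
  exact Nat.find_spec (hex n h) b

end Compact

/-! ### Finite sets of actions -/

section Finite

theorem dirac_mem_stdSimplex {A : Type*} [Fintype A] (a : A) : dirac a ∈ stdSimplex ℝ A := by
  classical
  convert! single_mem_stdSimplex ℝ a

theorem sum_smul_dirac {A : Type*} [Fintype A] (x : A → ℝ) : ∑ a, x a • dirac a = x := by
  classical
  funext a
  simp [dirac, Pi.single_apply]

theorem sum_mul_le_of_concaveOn {A : Type*} [Fintype A] {ψ : (A → ℝ) → ℝ}
    (hψ : ConcaveOn ℝ (stdSimplex ℝ A) ψ) {x : A → ℝ} (hx : x ∈ stdSimplex ℝ A) :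
    ∑ a, x a * ψ (dirac a) ≤ ψ x := by
  have h := hψ.le_map_sum (t := Finset.univ) (w := x) (p := dirac) (fun a _ => hx.1 a) hx.2
    fun a _ => dirac_mem_stdSimplex a
  rwa [sum_smul_dirac] at h

variable {A B : Type*} [Fintype A] [Fintype B] [MeasurableSpace A] [MeasurableSingletonClass A]
  [MeasurableSpace B] [MeasurableSingletonClass B]

/-- The probability distribution given by an element of the simplex. -/
def simplexMeasure (x : A → ℝ) : Measure A := ∑ a, ENNReal.ofReal (x a) • Measure.dirac a

omit [MeasurableSingletonClass A] in
theorem isProbabilityMeasure_simplexMeasure {x : A → ℝ} (hx : x ∈ stdSimplex ℝ A) :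
    IsProbabilityMeasure (simplexMeasure x) := ⟨by
  simp [simplexMeasure, ← ENNReal.ofReal_sum_of_nonneg fun a _ => hx.1 a, hx.2]⟩

theorem integral_simplexMeasure {x : A → ℝ} (hx : x ∈ stdSimplex ℝ A) (ψ : A → ℝ) :
    ∫ a, ψ a ∂(simplexMeasure x) = ∑ a, x a * ψ a := by
  rw [simplexMeasure, integral_finsetSum_measure fun a _ => .smul_measure
    (integrable_dirac (by simp)) ENNReal.ofReal_ne_top]
  simp [ENNReal.toReal_ofReal (hx.1 _)]

variable {g : (A → ℝ) → (B → ℝ) → H}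

theorem exists_mixed_response_of_approachable (hC : IsClosed C) (hconv : Convex ℝ C)
    (hg : IsBiaffineOn (stdSimplex ℝ A) (stdSimplex ℝ B) g)
    (hgc : ContinuousOn (Function.uncurry g) (stdSimplex ℝ A ×ˢ stdSimplex ℝ B))
    (h : Approachable (fun (a : A) (b : B) => g (dirac a) (dirac b)) C) (y : B → ℝ)
    (hy : y ∈ stdSimplex ℝ B) : ∃ x ∈ stdSimplex ℝ A, g x y ∈ C := by
  by_contra! hcon
  obtain ⟨φ, r, δ, hδ, hr, hφ⟩ := exists_functional_of_forall_notMem hC hconv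
    (isCompact_stdSimplex ℝ A) (convex_stdSimplex ℝ A) hg hgc hy hcon
  obtain ⟨R, hR⟩ := exists_abs_le (isCompact_stdSimplex ℝ A) (isCompact_stdSimplex ℝ B) hgc φ
  have := isProbabilityMeasure_simplexMeasure hy
  refine not_approachable hδ hφ .of_discrete
    (fun a b => hR _ (dirac_mem_stdSimplex a) _ (dirac_mem_stdSimplex b)) (simplexMeasure y)
    (fun a => ?_) h
  rw [integral_simplexMeasure hy]
  -- Drawing Nature's action from `y` averages the payoffs to `g (dirac a) y`, which the separating
  -- functional controls.
  exact (sum_mul_le_of_concaveOn (hg.concaveOn_right (convex_stdSimplex ℝ B) φ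
    (dirac_mem_stdSimplex a)) hy).trans (hr _ (dirac_mem_stdSimplex a))

theorem approachable_of_mixed_response [Nonempty A] [Nonempty B] (hconv : Convex ℝ C)
    (hg : IsBiaffineOn (stdSimplex ℝ A) (stdSimplex ℝ B) g)
    (hgc : ContinuousOn (Function.uncurry g) (stdSimplex ℝ A ×ˢ stdSimplex ℝ B))
    (hresp : ∀ y ∈ stdSimplex ℝ B, ∃ x ∈ stdSimplex ℝ A, g x y ∈ C) :
    Approachable (fun (a : A) (b : B) => g (dirac a) (dirac b)) C := by
  have hAne : (stdSimplex ℝ A).Nonempty := ⟨_, dirac_mem_stdSimplex (Classical.arbitrary A)⟩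
  have hBne : (stdSimplex ℝ B).Nonempty := ⟨_, dirac_mem_stdSimplex (Classical.arbitrary B)⟩
  obtain ⟨Γ, f, c, R, hCne, hΓne, hΓ, hgΓ, hf⟩ := exists_isTestFamily_of_response hconv
    (isCompact_stdSimplex ℝ A) hBne (isCompact_stdSimplex ℝ B) hgc hresp
  set g' : A → B → H := fun a b => g (dirac a) (dirac b)
  have hg'Γ : ∀ a b, g' a b ∈ Γ := fun a b =>
    hgΓ _ (dirac_mem_stdSimplex a) _ (dirac_mem_stdSimplex b)
  have hex : ∀ (n : ℕ) (h : Fin n → A × B), ∃ x ∈ stdSimplex ℝ A, ∀ y ∈ stdSimplex ℝ B,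
      coupling (total (excess g' f c) h) (fun j => f j (g x y) - c j) ≤ 0 := fun n h =>
    hf.exists_coupling_nonpos hgΓ hAne (isCompact_stdSimplex ℝ A) (convex_stdSimplex ℝ A)
      hBne (isCompact_stdSimplex ℝ B) (convex_stdSimplex ℝ B) hg hgc hresp
      (abs_total_le (hf.abs_excess_le hg'Γ) h)
  choose x hx hxy using hex
  refine approachable_of_coupling_le hf hCne hΓne hΓ hg'Γ (fun j => .of_discrete)
    ⟨fun n => ⟨fun h => simplexMeasure (x n h), .of_discrete⟩,
      fun n => ⟨fun h => isProbabilityMeasure_simplexMeasure (hx n h)⟩⟩ fun n h b => ?_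
  obtain ⟨φ, e, hφ⟩ := hf.coupling_eq hΓne (abs_total_le (hf.abs_excess_le hg'Γ) h)
  have h1 := hxy n h _ (dirac_mem_stdSimplex b)
  rw [hφ _ (hgΓ _ (hx n h) _ (dirac_mem_stdSimplex b))] at h1
  -- Affinity in the player's variable bounds the expected coupling over the drawn action by the
  -- coupling at the mixed action, which is nonpositive.
  have h2 := sum_mul_le_of_concaveOn (hg.concaveOn_left (convex_stdSimplex ℝ A) φ
    (dirac_mem_stdSimplex b)) (hx n h)
  have h3 : ∀ a, coupling (total (excess g' f c) h) (fun j => excess g' f c j (a, b)) =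
      φ (g (dirac a) (dirac b)) - e := fun a => hφ _ (hg'Γ a b)
  change ∫ a, _ ∂(simplexMeasure (x n h)) ≤ 1
  rw [integral_simplexMeasure (hx n h)]
  simp_rw [h3, mul_sub]
  rw [Finset.sum_sub_distrib, ← Finset.sum_mul, (hx n h).2]
  linarith

end Finite

end Main

end RepeatedGame

end

theorem mainTheorem12 {H : Type*} [NormedAddCommGroup H] [NormedSpace ℝ H]
    (C : Set H) (hC : IsClosed C) (hconv : Convex ℝ C) :
    -- finitely many actions, mixed actions in the simplices
    (∀ (A B : Type*) [Fintype A] [Nonempty A] [Fintype B] [Nonempty B]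
        [MeasurableSpace A] [MeasurableSingletonClass A]
        [MeasurableSpace B] [MeasurableSingletonClass B]
        (g : (A → ℝ) → (B → ℝ) → H),
        RepeatedGame.IsBiaffineOn (stdSimplex ℝ A) (stdSimplex ℝ B) g →
        ContinuousOn (Function.uncurry g) (stdSimplex ℝ A ×ˢ stdSimplex ℝ B) →
        (RepeatedGame.Approachable
            (fun (a : A) (b : B) => g (RepeatedGame.dirac a) (RepeatedGame.dirac b)) C ↔
          ∀ y ∈ stdSimplex ℝ B, ∃ x ∈ stdSimplex ℝ A, g x y ∈ C)) ∧
    -- compact convex sets of actions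
    (∀ (E F : Type*) [AddCommGroup E] [Module ℝ E] [TopologicalSpace E]
        [IsTopologicalAddGroup E] [ContinuousSMul ℝ E] [T2Space E]
        [AddCommGroup F] [Module ℝ F] [TopologicalSpace F]
        [IsTopologicalAddGroup F] [ContinuousSMul ℝ F] [T2Space F]
        (K : Set E) (L : Set F) (g : E → F → H),
        K.Nonempty → IsCompact K → Convex ℝ K →
        L.Nonempty → IsCompact L → Convex ℝ L →
        RepeatedGame.IsBiaffineOn K L g →
        ContinuousOn (Function.uncurry g) (K ×ˢ L) →
        -- pure strategies
        (RepeatedGame.PurelyApproachable (fun (a : K) (b : L) => g a b) C ↔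
          ∀ y ∈ L, ∃ x ∈ K, g x y ∈ C) ∧
        -- randomized strategies
        (∀ [MeasurableSpace K] [BorelSpace K] [TopologicalSpace.MetrizableSpace K]
            [MeasurableSpace L] [BorelSpace L] [TopologicalSpace.MetrizableSpace L],
          (RepeatedGame.Approachable (fun (a : K) (b : L) => g a b) C ↔
            ∀ y ∈ L, ∃ x ∈ K, g x y ∈ C))) := by
  refine ⟨fun A B _ _ _ _ _ _ _ _ g hg hgc => ?_,
    fun E F _ _ _ _ _ _ _ _ _ _ _ _ K L g hKne hK hKc hLne hL hLc hg hgc => ⟨?_, ?_⟩⟩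
  · exact ⟨RepeatedGame.exists_mixed_response_of_approachable hC hconv hg hgc,
      RepeatedGame.approachable_of_mixed_response hconv hg hgc⟩
  · exact ⟨RepeatedGame.exists_response_of_purelyApproachable hC hconv hK hKc hg hgc,
      RepeatedGame.purelyApproachable_of_response hconv hKne hK hKc hLne hL hLc hg hgc⟩
  · intro _ _ _ _ _ _
    exact ⟨RepeatedGame.exists_response_of_approachable hC hconv hK hKc hL hg hgc,
      fun h => RepeatedGame.approachable_of_response hconv hKne hK hKc hLne hL hLc hg hgc h⟩
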